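/- **Setting.** Let $S$ be a compact Polish space and $\Omega$ the set of right-continuous paths $[0,\infty)\to S$ with left limits, with the $\sigma$-algebra generated by the evaluations $V_t(\omega)=\omega(t)$. Let $(\mathbb P_x)_{x\in S}$ be probability measures on $\Omega$, depending measurably on $x$, with $\mathbb P_x(V_0=x)=1$, under which $(V_t)_{t\ge0}$ is a Feller process, i.e. a time-homogeneous Markov process for which $x\mapsto\mathbb E_x[h(V_t)]$ is continuous for every continuous $h$ and every $t\ge 0$. Put $\mathbb P_\mu=\int_S\mathbb P_y\,\mu(\mathrm dy)$. Assume that: 1. $(V_t)$ has a unique invariant probability measure $\pi$. 2. There are constants $C,\delta>0$ such that for every $x\in S$ there are, on a common filtered probability space $(\tilde\Omega,\tilde{\mathcal F},(\mathcal G_t)_{t\ge0},\tilde{\mathbb P})$, càdlàg processes $(V^x_t)_{t\ge0}$ and $(V^\pi_t)_{t\ge0}$ which have the law of $(V_t)_{t\ge0}$ under $\mathbb P_x$ and under $\mathbb P_\pi$, respectively, are both Markov with respect to $(\mathcal G_t)$ with the transition kernels of $(V_t)$, and for which $T^x=\inf\{t\ge0: V^x_t=V^\pi_t\}$ is a $(\mathcal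 G_t)$-stopping time with $\tilde{\mathbb P}(T^x\ge t)\le C\exp(-\delta t)$ for all $t\ge0$. Let $f:\mathbb R^K\times S\to\mathbb R$ be continuous and $C^2$ in $\theta$, with $\nabla_\theta f$ and $H_\theta f$ (gradient and Hessian in $\theta$) continuous on $\mathbb R^K\times S$ and $\nabla_\theta f(\cdot,y)$ Lipschitz uniformly in $y\in S$. Let $\kappa>0$ be such that $$\langle x_1-x_2,\nabla_\theta f(x_1,y)-\nabla_\theta f(x_2,y)\rangle\ge\kappa\|x_1-x_2\|^2\qquad(x_1,x_2\in\mathbb R^K,\ y\in S).$$ For $\varepsilon>0$ and $m\in\mathbb R^K$ let $(\theta^\varepsilon_t)_{t\ge0}$ be the solution of $\mathrm d\theta^\varepsilon_t=-\nabla_\theta f(\theta^\varepsilon_t,V_{t/\varepsilon})\,\mathrm dt$, $\theta^\varepsilon_0=m$. For $a\in S$ let $H^\varepsilon_t(\cdot|m,a)$ and $H^\varepsilon_t(\cdot|m,\pi)$ be the laws of $(\theta^\varepsilon_t,V_{t/\varepsilon})$ under $\mathbb P_a$ and $\mathbb P_\pi$, and $C^\varepsilon_t(\cdot|m,a)$ and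 $C^\varepsilon_t(\cdot|m,\pi)$ the laws of $\theta^\varepsilon_t$ under $\mathbb P_a$ and $\mathbb P_\pi$. Let $\mathcal W_d(\mu,\nu)=\inf_\Gamma\int d\,\mathrm d\Gamma$ and $\widetilde{\mathcal W}_{\tilde d}(\mu,\nu)=\inf_\Gamma\int\tilde d\,\mathrm d\Gamma$, the infima being over all couplings $\Gamma$ of $\mu$ and $\nu$, with $d(u,u')=1\wedge\|u-u'\|$ on $\mathbb R^K$ and $\tilde d((u,v),(u',v'))=\mathbf 1_{v\ne v'}+(1\wedge\|u-u'\|)\mathbf 1_{v=v'}$ on $\mathbb R^K\times S$. **Claim.** For every $0<\varepsilon\le1\wedge\frac{\delta}{2\kappa}$ the Markov process $(\theta^\varepsilon_t,V_{t/\varepsilon})_{t\ge0}$ has a unique stationary probability measure $\Pi^\varepsilon$ on $\mathbb R^K\times S$. Moreover, for every $m\in\mathbb R^K$ there is a constant $C_{f,m}$, depending only on $f$ (including its domain and the constant $\kappa$), on $m$ and on the constant $C$ in 2 (in particular not on $\varepsilon$, $t$, $a$, $\delta$, and on the index process only through $C$), such that for all such $\varepsilon$, all $a\in S$ and all $t\ge0$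 $$\widetilde{\mathcal W}_{\tilde d}(H^\varepsilon_t(\cdot|m,a),\Pi^\varepsilon)\le C_{f,m}e^{-\kappa t/2},\qquad \widetilde{\mathcal W}_{\tilde d}(H^\varepsilon_t(\cdot|m,\pi),\Pi^\varepsilon)\le C_{f,m}e^{-\kappa t/2},$$ $$\mathcal W_d(C^\varepsilon_t(\cdot|m,a),\Pi^\varepsilon(\cdot,S))\le C_{f,m}e^{-\kappa t/2},\qquad \mathcal W_d(C^\varepsilon_t(\cdot|m,\pi),\Pi^\varepsilon(\cdot,S))\le C_{f,m}e^{-\kappa t/2},$$ $$\mathcal W_d(C^\varepsilon_t(\cdot|m,a),C^\varepsilon_t(\cdot|m,\pi))\le C_{f,m}e^{-\kappa t/2}.$$ -/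

import Mathlib

open MeasureTheory ProbabilityTheory Filter Topology Set
open scoped NNReal ENNReal

universe u v

noncomputable section

/-- The parameter space `ℝ^K` with its Euclidean norm. -/
abbrev ParamSpace (K : ℕ) : Type := EuclideanSpace ℝ (Fin K)

/-! ### Càdlàg paths and Feller processes on the canonical path space -/

/-- The set `Ω` of right-continuous paths with left limits `[0, ∞) → S`. -/
def CadlagPath (S : Type u) [TopologicalSpace S] : Type u :=
  {ω : ℝ≥0 → S // ∀ t, ContinuousWithinAt ω (Ici t) t ∧ ∃ l, Tendsto ω (𝓝[<] t) (𝓝 l)}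

instance (S : Type u) [TopologicalSpace S] : CoeFun (CadlagPath S) fun _ => ℝ≥0 → S :=
  ⟨Subtype.val⟩

/-- The smallest σ-algebra on `Ω` for which all evaluations `ω ↦ ω t` are measurable. -/
instance (S : Type u) [TopologicalSpace S] [MeasurableSpace S] : MeasurableSpace (CadlagPath S) :=
  ⨆ t : ℝ≥0, MeasurableSpace.comap (fun ω : CadlagPath S => ω t) inferInstance

theorem CadlagPath.measurable_eval {S : Type u} [TopologicalSpace S] [MeasurableSpace S]
    (t : ℝ≥0) : Measurable (fun ω : CadlagPath S => ω t) :=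
  measurable_iff_comap_le.2
    (le_iSup (fun t : ℝ≥0 =>
      MeasurableSpace.comap (fun ω : CadlagPath S => ω t) inferInstance) t)

/-- The filtration generated by the coordinate process `V_t(ω) = ω t`. -/
def canonicalFiltration (S : Type u) [TopologicalSpace S] [MeasurableSpace S] :
    Filtration ℝ≥0 (inferInstance : MeasurableSpace (CadlagPath S)) where
  seq t := ⨆ s : {s : ℝ≥0 // s ≤ t},
    MeasurableSpace.comap (fun ω : CadlagPath S => ω s.1) inferInstance
  mono' _ t h := iSup_le fun s =>
    le_iSup (fun r : {r : ℝ≥0 // r ≤ t} =>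
      MeasurableSpace.comap (fun ω : CadlagPath S => ω r.1) inferInstance) ⟨s.1, s.2.trans h⟩
  le' _ := iSup_le fun s => measurable_iff_comap_le.1 (CadlagPath.measurable_eval s.1)

/-- The transition kernel `p_t(x, A) = ℙ_x(V_t ∈ A)` of the family of laws `(ℙ_x)`. -/
def transition {S : Type u} [TopologicalSpace S] [MeasurableSpace S]
    (P : Kernel S (CadlagPath S)) (t : ℝ≥0) : Kernel S S :=
  P.map fun ω => ω t

/-- `X` is adapted to `𝒢` and is a Markov process with respect to `𝒢` under `μ`, with transition
kernels `p`: `μ(X_{s+t} ∈ A | 𝒢_s) = p_t(X_s, A)`. -/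
def IsMarkovWith {S : Type u} [MeasurableSpace S] {Ω : Type v} {mΩ : MeasurableSpace Ω}
    (𝒢 : Filtration ℝ≥0 mΩ) (μ : Measure Ω) (p : ℝ≥0 → Kernel S S) (X : ℝ≥0 → Ω → S) : Prop :=
  (∀ t, Measurable[𝒢 t] (X t)) ∧
  ∀ (s t : ℝ≥0) (A : Set S) (B : Set Ω), MeasurableSet A → MeasurableSet[𝒢 s] B →
    μ (B ∩ X (s + t) ⁻¹' A) = ∫⁻ ω in B, p t (X s ω) A ∂μ

/-- `(ℙ_x)_{x ∈ S}` are the laws of a càdlàg Feller process `V_t(ω) = ω t` with `V_0 = x` almost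
surely under `ℙ_x`: each `ℙ_x` is a probability measure, `V` is a time-homogeneous Markov process
under each `ℙ_x`, and `x ↦ 𝔼_x[h(V_t)]` is continuous for every continuous `h`. -/
structure IsFellerProcess {S : Type u} [TopologicalSpace S] [MeasurableSpace S]
    (P : Kernel S (CadlagPath S)) : Prop where
  isProbability : ∀ x, IsProbabilityMeasure (P x)
  start : ∀ x, ∀ᵐ ω ∂(P x), ω 0 = x
  markov : ∀ x, IsMarkovWith (canonicalFiltration S) (P x) (transition P) fun t ω => ω t
  feller : ∀ (h : C(S, ℝ)) (t : ℝ≥0), Continuous fun x => ∫ ω, h (ω t) ∂(P x)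

/-- `π` is an invariant probability measure of the process with laws `(ℙ_x)`. -/
def IsInvariantLaw {S : Type u} [TopologicalSpace S] [MeasurableSpace S]
    (P : Kernel S (CadlagPath S)) (π : Measure S) : Prop :=
  IsProbabilityMeasure π ∧ ∀ t, (transition P t).Invariant π

/-- The law `ℙ_μ = ∫ ℙ_y μ(dy)` of the process started from the distribution `μ`. -/
def lawFrom {S : Type u} [TopologicalSpace S] [MeasurableSpace S]
    (P : Kernel S (CadlagPath S)) (μ : Measure S) : Measure (CadlagPath S) :=
  μ.bind P

/-- The coupling property with constants `C, δ`. For every `x`, on some filtered probability space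
there are càdlàg processes `X` (a version of `V` under `ℙ_x`) and `Y` (a version of `V` under
`ℙ_π`), both Markov with respect to the filtration, whose first meeting time
`T = inf {t ≥ 0 | X_t = Y_t}` is a stopping time with `μ(T ≥ t) ≤ C exp(-δ t)`. -/
def HasExponentialCoupling {S : Type u} [TopologicalSpace S] [MeasurableSpace S]
    (P : Kernel S (CadlagPath S)) (π : Measure S) (C δ : ℝ) : Prop :=
  ∀ x : S, ∃ (Ω : Type v) (mΩ : MeasurableSpace Ω) (μ : Measure Ω) (𝒢 : Filtration ℝ≥0 mΩ)
    (X Y : Ω → CadlagPath S),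
    IsProbabilityMeasure μ ∧
    Measurable X ∧ Measurable Y ∧
    μ.map X = P x ∧ μ.map Y = lawFrom P π ∧
    IsMarkovWith 𝒢 μ (transition P) (fun t ω => X ω t) ∧
    IsMarkovWith 𝒢 μ (transition P) (fun t ω => Y ω t) ∧
    IsStoppingTime 𝒢 (hittingAfter (fun t ω => (X ω t, Y ω t)) (diagonal S) (0 : ℝ≥0)) ∧
    ∀ t : ℝ≥0,
      μ {ω | (t : WithTop ℝ≥0) ≤
        hittingAfter (fun t ω => (X ω t, Y ω t)) (diagonal S) (0 : ℝ≥0) ω} ≤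
      ENNReal.ofReal (C * Real.exp (-δ * t))

/-! ### The target function -/

/-- The gradient `∇_θ f(θ, y)`. -/
def gradTarget {S : Type u} {K : ℕ} (f : ParamSpace K → S → ℝ) (θ : ParamSpace K) (y : S) :
    ParamSpace K :=
  gradient (fun θ' => f θ' y) θ

/-- The Hessian `H_θ f(θ, y)`, as the derivative of the gradient. -/
def hessTarget {S : Type u} {K : ℕ} (f : ParamSpace K → S → ℝ) (θ : ParamSpace K) (y : S) :
    ParamSpace K →L[ℝ] ParamSpace K :=
  fderiv ℝ (fun θ' => gradTarget f θ' y) θ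

/-- `f` is continuous and twice continuously differentiable in `θ`, with `∇_θ f` and `H_θ f`
jointly continuous, and `∇_θ f` is Lipschitz in `θ` uniformly in `y`. -/
structure IsRegularTarget {S : Type u} [TopologicalSpace S] {K : ℕ}
    (f : ParamSpace K → S → ℝ) : Prop where
  continuous : Continuous fun z : ParamSpace K × S => f z.1 z.2
  contDiff : ∀ y, ContDiff ℝ 2 fun θ => f θ y
  continuous_grad : Continuous fun z : ParamSpace K × S => gradTarget f z.1 z.2
  continuous_hess : Continuous fun z : ParamSpace K × S => hessTarget f z.1 z.2
  lipschitz_grad : ∃ L : ℝ≥0, ∀ y, LipschitzWith L fun θ => gradTarget f θ y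

/-- Strong convexity of `f(·, y)` with a parameter `κ` that does not depend on `y`. -/
def IsUniformlyStronglyConvex {S : Type u} {K : ℕ} (f : ParamSpace K → S → ℝ) (κ : ℝ) : Prop :=
  ∀ (y : S) (x₁ x₂ : ParamSpace K),
    κ * ‖x₁ - x₂‖ ^ 2 ≤ inner ℝ (x₁ - x₂) (gradTarget f x₁ y - gradTarget f x₂ y)

/-! ### The stochastic gradient process with constant learning rate -/

/-- `θ` solves `dθ_t = -∇_θ f(θ_t, w_{t/ε}) dt`, `θ_0 = m`, along the index path `w`. -/
def IsSGPPath {S : Type u} {K : ℕ} (f : ParamSpace K → S → ℝ) (ε : ℝ≥0) (m : ParamSpace K)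
    (w : ℝ≥0 → S) (θ : ℝ≥0 → ParamSpace K) : Prop :=
  Continuous θ ∧
  ∀ t : ℝ≥0, θ t =
    m - ∫ s in (0 : ℝ)..t, gradTarget f (θ s.toNNReal) (w (s.toNNReal / ε))

/-- The solution of the equation in `IsSGPPath`. It exists and is unique when `∇_θ f` is continuous
and Lipschitz in `θ` uniformly in `y`, and `w` is càdlàg. -/
def sgp {S : Type u} {K : ℕ} (f : ParamSpace K → S → ℝ) (ε : ℝ≥0) (m : ParamSpace K)
    (w : ℝ≥0 → S) : ℝ≥0 → ParamSpace K :=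
  Classical.epsilon (IsSGPPath f ε m w)

/-- The law of `(θ^ε_t, V_{t/ε})` with `θ^ε_0 = m`, when the index process has law `Q`. -/
def coupledLaw {S : Type u} [TopologicalSpace S] [MeasurableSpace S] {K : ℕ}
    (f : ParamSpace K → S → ℝ) (ε t : ℝ≥0) (m : ParamSpace K) (Q : Measure (CadlagPath S)) :
    Measure (ParamSpace K × S) :=
  Q.map fun ω : CadlagPath S => (sgp f ε m ω t, ω (t / ε))

/-- The law of `θ^ε_t` with `θ^ε_0 = m`, when the index process has law `Q`. -/
def sgpLaw {S : Type u} [TopologicalSpace S] [MeasurableSpace S] {K : ℕ}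
    (f : ParamSpace K → S → ℝ) (ε t : ℝ≥0) (m : ParamSpace K) (Q : Measure (CadlagPath S)) :
    Measure (ParamSpace K) :=
  Q.map fun ω : CadlagPath S => sgp f ε m ω t

/-- `M` is a stationary probability measure of the Markov process `(θ^ε_t, V_{t/ε})_{t ≥ 0}`. -/
def IsStationaryLaw {S : Type u} [TopologicalSpace S] [MeasurableSpace S] {K : ℕ}
    (f : ParamSpace K → S → ℝ) (ε : ℝ≥0) (P : Kernel S (CadlagPath S))
    (M : Measure (ParamSpace K × S)) : Prop :=
  IsProbabilityMeasure M ∧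
  ∀ (t : ℝ≥0) (B : Set (ParamSpace K × S)), MeasurableSet B →
    ∫⁻ z, coupledLaw f ε t z.1 (P z.2) B ∂M = M B

/-! ### Wasserstein distances -/

/-- `inf_Γ ∫ c dΓ` over all couplings `Γ` of `μ` and `ν`. -/
def wasserstein {X : Type u} [MeasurableSpace X] (c : X → X → ℝ) (μ ν : Measure X) : ℝ≥0∞ :=
  ⨅ (Γ : Measure (X × X)) (_ : Γ.map Prod.fst = μ ∧ Γ.map Prod.snd = ν),
    ∫⁻ z, ENNReal.ofReal (c z.1 z.2) ∂Γ

/-- `d(u, u') = 1 ∧ ‖u - u'‖`. -/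
def truncDist {K : ℕ} (x x' : ParamSpace K) : ℝ := min 1 ‖x - x'‖

open Classical in
/-- `d̃((u, v), (u', v')) = 1_{v ≠ v'} + (1 ∧ ‖u - u'‖) 1_{v = v'}`. -/
def coupledDist {S : Type u} {K : ℕ} (z z' : ParamSpace K × S) : ℝ :=
  (if z.2 ≠ z'.2 then 1 else 0) + (if z.2 = z'.2 then truncDist z.1 z'.1 else 0)

end

/-! Everything rests on two pathwise consequences of strong convexity. Two solutions driven by the
same index path approach each other at rate `exp (-κ t)` (`IsSGPPath.norm_sub_le`), and a solution
started at `m` never leaves the ball of radius `R = ‖m‖ + B / κ`, where `B` bounds the gradient at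
the origin (`norm_sgp_le`). Neither bound involves `ε` or the law of the index process.

Under `ℙ_π` the index path is stationary, so restarting the equation from `m` along the path shifted
by `s / ε` gives the law of the coupled process at time `t`, while the unshifted solution gives the
law at time `s + t`. These two versions share their index and have parameters within `2 R exp (-κ
t)` (`areNear_coupledLaw`). All these laws live on one compact set, so a limit `M` exists along an
ultrafilter of integer times, and the couplings pass to the limit because the constraint set is
closed (`exists_limit_coupledLaw`).

Stationarity and uniqueness are tested on bounded functions that are Lipschitz in `θ` and merely
measurable in the index. The semigroup preserves this class by the contraction, so continuity of the
coupled semigroup in the index is never needed. Chapman-Kolmogorov makes `M` stationary. The index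
marginal of any stationary law is invariant, hence equal to `π`, and contraction makes its parameter
component forget the initial value, so the law is `M`.

For a start at a point `a`, the given coupling is used on the first half of `[0, t]` and contraction
on the second half. This needs index paths that stay together after meeting, whereas the hypothesis
only says that they meet. Hence the second process is replaced by one that follows it up to the
meeting time and the first one afterwards. That the law is unchanged is a strong Markov property at
the meeting time (`measure_inter_meeting`, `IsMarkovWith.glue`). It is proved for occupation
integrals, because their means are jointly continuous in time and state, and then differentiated in
time. -/

noncomputable section

/-! ### Approximating times from above, and measurability of càdlàg paths -/

/-- The smallest multiple of `1 / (n + 1)` that is strictly greater than `t`. -/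
def gridAbove (n : ℕ) (t : ℝ≥0) : ℝ≥0 := (⌊((n : ℝ≥0) + 1) * t⌋₊ + 1 : ℝ≥0) / (n + 1)

theorem lt_gridAbove (n : ℕ) (t : ℝ≥0) : t < gridAbove n t := by
  rw [gridAbove, lt_div_iff₀ (by positivity), mul_comm]
  exact Nat.lt_floor_add_one _

theorem gridAbove_le (n : ℕ) (t : ℝ≥0) : gridAbove n t ≤ t + 1 / (n + 1) := by
  have h : (t + 1 / ((n : ℝ≥0) + 1)) * (n + 1) = ((n : ℝ≥0) + 1) * t + 1 := by field_simp
  rw [gridAbove, div_le_iff₀ (by positivity), h]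
  exact add_le_add_left (Nat.floor_le (by positivity)) 1

theorem tendsto_gridAbove (t : ℝ≥0) : Tendsto (fun n => gridAbove n t) atTop (𝓝[≥] t) := by
  refine tendsto_nhdsWithin_iff.2 ⟨?_, Eventually.of_forall fun n => (lt_gridAbove n t).le⟩
  refine tendsto_of_tendsto_of_tendsto_of_le_of_le tendsto_const_nhds ?_
    (fun n => (lt_gridAbove n t).le) (fun n => gridAbove_le n t)
  simpa using (tendsto_const_nhds (x := t)).add (tendsto_one_div_add_atTop_nhds_zero_nat (𝕜 := ℝ≥0))

section Paths

variable {S : Type u} [TopologicalSpace S]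

theorem CadlagPath.continuousWithinAt (ω : CadlagPath S) (t : ℝ≥0) :
    ContinuousWithinAt ω (Ici t) t := (ω.2 t).1

theorem CadlagPath.tendsto_gridAbove (ω : CadlagPath S) (t : ℝ≥0) :
    Tendsto (fun n => ω (gridAbove n t)) atTop (𝓝 (ω t)) :=
  (ω.continuousWithinAt t).tendsto.comp (_root_.tendsto_gridAbove t)

/-- The path `t ↦ ω (r + t)`. -/
def CadlagPath.shift (r : ℝ≥0) (ω : CadlagPath S) : CadlagPath S :=
  ⟨fun t => ω (r + t), fun t => by
    refine ⟨(ω.continuousWithinAt (r + t)).comp (by fun_prop) fun s hs => ?_, ?_⟩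
    · exact add_le_add_right hs r
    · obtain ⟨l, hl⟩ := (ω.2 (r + t)).2
      refine ⟨l, hl.comp (tendsto_nhdsWithin_iff.2 ⟨?_, ?_⟩)⟩
      · exact (Continuous.tendsto (by fun_prop) t).mono_left nhdsWithin_le_nhds
      · filter_upwards [self_mem_nhdsWithin] with s hs
        exact add_lt_add_right hs r⟩

theorem CadlagPath.shift_apply (r : ℝ≥0) (ω : CadlagPath S) (t : ℝ≥0) : ω.shift r t = ω (r + t) :=
  rfl

open Classical in
/-- The path which follows `ω` before the time `T` and `ω'` from `T` on. -/
def CadlagPath.glue (T : WithTop ℝ≥0) (ω ω' : CadlagPath S) : CadlagPath S :=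
  ⟨fun t => if T ≤ t then ω' t else ω t, fun t => by
    constructor
    · by_cases h : T ≤ t
      · refine (ω'.continuousWithinAt t).congr (fun s hs => ?_) (if_pos h)
        exact if_pos (h.trans (WithTop.coe_le_coe.2 hs))
      · refine (ω.continuousWithinAt t).congr_of_eventuallyEq ?_ (if_neg h)
        have : {s : ℝ≥0 | (s : WithTop ℝ≥0) < T} ∈ 𝓝 t := by
          induction T using WithTop.recTopCoe with
          | top => exact univ_mem' fun s => WithTop.coe_lt_top s
          | coe a =>
            refine mem_of_superset (Iio_mem_nhds (a := a) ?_) fun s hs => WithTop.coe_lt_coe.2 hs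
            exact not_le.1 fun h' => h (WithTop.coe_le_coe.2 h')
        filter_upwards [mem_nhdsWithin_of_mem_nhds this] with s hs
        exact if_neg (not_le.2 hs)
    · by_cases h : T < t
      · obtain ⟨l, hl⟩ := (ω'.2 t).2
        refine ⟨l, hl.congr' ?_⟩
        lift T to ℝ≥0 using h.ne_top
        filter_upwards [mem_nhdsWithin_of_mem_nhds (Ioi_mem_nhds (WithTop.coe_lt_coe.1 h))]
          with s hs
        exact (if_pos (WithTop.coe_le_coe.2 (le_of_lt (mem_Ioi.1 hs)))).symm
      · obtain ⟨l, hl⟩ := (ω.2 t).2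
        refine ⟨l, hl.congr' ?_⟩
        filter_upwards [self_mem_nhdsWithin] with s hs
        have : ¬ T ≤ s := fun h' => h (h'.trans_lt (WithTop.coe_lt_coe.2 hs))
        exact (if_neg this).symm⟩

theorem CadlagPath.glue_apply_of_le {T : WithTop ℝ≥0} {t : ℝ≥0} (h : T ≤ t) (ω ω' : CadlagPath S) :
    glue T ω ω' t = ω' t :=
  if_pos h

theorem CadlagPath.glue_apply_of_lt {T : WithTop ℝ≥0} {t : ℝ≥0} (h : t < T) (ω ω' : CadlagPath S) :
    glue T ω ω' t = ω t :=
  if_neg (not_le.2 h)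

/-- The path `ω` stopped at the time `r`. -/
def CadlagPath.stopAt (r : ℝ≥0) (ω : CadlagPath S) : CadlagPath S :=
  glue r ω ⟨fun _ => ω r, fun _ => ⟨continuousWithinAt_const, ω r, tendsto_const_nhds⟩⟩

theorem CadlagPath.stopAt_apply_of_le {r t : ℝ≥0} (h : t ≤ r) (ω : CadlagPath S) :
    ω.stopAt r t = ω t := by
  rcases h.lt_or_eq with h | rfl
  · exact glue_apply_of_lt (WithTop.coe_lt_coe.2 h) _ _
  · exact glue_apply_of_le le_rfl _ _

variable [MeasurableSpace S]

theorem measurable_cadlagPath_iff {Ω : Type*} {mΩ : MeasurableSpace Ω} {X : Ω → CadlagPath S} :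
    Measurable X ↔ ∀ t, Measurable fun ω => X ω t := by
  refine ⟨fun h t => (CadlagPath.measurable_eval t).comp h, fun h => ?_⟩
  rw [measurable_iff_comap_le]
  change MeasurableSpace.comap X (⨆ t : ℝ≥0, _) ≤ _
  rw [MeasurableSpace.comap_iSup]
  refine iSup_le fun t => ?_
  rw [MeasurableSpace.comap_comp]
  exact measurable_iff_comap_le.1 (h t)

/-- Right-continuity makes evaluation a limit of evaluations at grid times, and each of these takes
only countably many times. -/
theorem measurable_cadlagPath_uncurry [PolishSpace S] [BorelSpace S] :
    Measurable fun p : ℝ≥0 × CadlagPath S => p.2 p.1 := by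
  refine measurable_of_tendsto_metrizable (f := fun n p => p.2 (gridAbove n p.1)) (fun n => ?_)
    (tendsto_pi_nhds.2 fun p => p.2.tendsto_gridAbove p.1)
  have h : Measurable fun q : ℕ × CadlagPath S => q.2 (((q.1 : ℝ≥0) + 1) / (n + 1)) :=
    measurable_from_prod_countable_right fun k =>
      CadlagPath.measurable_eval (((k : ℝ≥0) + 1) / (n + 1))
  have h2 : Measurable fun p : ℝ≥0 × CadlagPath S => (⌊((n : ℝ≥0) + 1) * p.1⌋₊, p.2) :=
    (Nat.measurable_floor.comp (measurable_fst.const_mul _)).prodMk measurable_snd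
  exact h.comp h2

theorem CadlagPath.measurable_coe [PolishSpace S] [BorelSpace S] (ω : CadlagPath S) :
    Measurable (ω : ℝ≥0 → S) :=
  measurable_cadlagPath_uncurry.comp (measurable_id.prodMk measurable_const)

theorem CadlagPath.measurable_shift (r : ℝ≥0) :
    Measurable (CadlagPath.shift r : CadlagPath S → CadlagPath S) :=
  measurable_cadlagPath_iff.2 fun _ => CadlagPath.measurable_eval _

/-- This turns "depends only on the path up to `r`" into measurability with respect to the past: a
measurable functional with that property is its own composition with stopping at `r`. -/
theorem CadlagPath.measurable_stopAt (r : ℝ≥0) :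
    Measurable[canonicalFiltration S r] (CadlagPath.stopAt r : CadlagPath S → CadlagPath S) := by
  have key : ∀ s ≤ r, Measurable[canonicalFiltration S r] fun ω : CadlagPath S => ω s :=
    fun s hs => measurable_iff_comap_le.2 (le_iSup (fun s : {s : ℝ≥0 // s ≤ r} =>
      MeasurableSpace.comap (fun ω : CadlagPath S => ω s.1) inferInstance) ⟨s, hs⟩)
  refine (@measurable_cadlagPath_iff S _ _ _ (canonicalFiltration S r) _).2 fun t => ?_
  rcases le_total t r with h | h
  · simpa only [stopAt_apply_of_le h] using key t h
  · have : (fun ω : CadlagPath S => ω.stopAt r t) = fun ω => ω r :=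
      funext fun ω => glue_apply_of_le (WithTop.coe_le_coe.2 h) _ _
    exact this ▸ key r le_rfl

end Paths

/-! ### The stochastic gradient equation along a càdlàg path -/

theorem IsSGPPath.apply_zero {S : Type u} {K : ℕ} {f : ParamSpace K → S → ℝ} {ε : ℝ≥0}
    {m : ParamSpace K} {ω : ℝ≥0 → S} {x : ℝ≥0 → ParamSpace K} (hx : IsSGPPath f ε m ω x) :
    x 0 = m := by
  simpa using hx.2 0

section Equation

variable {S : Type u} [TopologicalSpace S] {K : ℕ} {f : ParamSpace K → S → ℝ}

/-- The gradient along the trajectory `x` when the index process is `ω`, run at speed `1 / ε`. -/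
def drift (f : ParamSpace K → S → ℝ) (ε : ℝ≥0) (x : ℝ≥0 → ParamSpace K) (ω : ℝ≥0 → S) (s : ℝ) :
    ParamSpace K :=
  gradTarget f (x s.toNNReal) (ω (s.toNNReal / ε))

theorem IsRegularTarget.exists_lipschitz (hf : IsRegularTarget f) :
    ∃ L : ℝ, 1 ≤ L ∧ ∀ x y v, ‖gradTarget f x v - gradTarget f y v‖ ≤ L * ‖x - y‖ := by
  obtain ⟨L, hL⟩ := hf.lipschitz_grad
  refine ⟨max 1 L, le_max_left _ _, fun x y v => ?_⟩
  have := (hL v).dist_le_mul x y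
  rw [dist_eq_norm, dist_eq_norm] at this
  exact this.trans (by gcongr; exact le_max_right _ _)

theorem IsRegularTarget.continuousWithinAt_drift (hf : IsRegularTarget f) (ε : ℝ≥0)
    {x : ℝ≥0 → ParamSpace K} (hx : Continuous x) (ω : CadlagPath S) (s : ℝ) :
    ContinuousWithinAt (drift f ε x ω) (Ici s) s := by
  have h1 : ContinuousWithinAt (fun r : ℝ => ω (r.toNNReal / ε)) (Ici s) s :=
    (ω.continuousWithinAt (s.toNNReal / ε)).comp (f := fun r : ℝ => r.toNNReal / ε)
      (Continuous.continuousWithinAt (by fun_prop)) fun r hr => by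
        simp only [mem_Ici] at hr ⊢
        gcongr
  exact hf.continuous_grad.continuousAt.comp_continuousWithinAt
    (f := fun r : ℝ => (x r.toNNReal, ω (r.toNNReal / ε)))
    ((Continuous.continuousWithinAt (by fun_prop)).prodMk h1)

theorem IsRegularTarget.exists_bound [CompactSpace S] (hf : IsRegularTarget f) {A : Set (ParamSpace K)}
    (hA : IsCompact A) : ∃ B, 0 ≤ B ∧ ∀ x ∈ A, ∀ v, ‖gradTarget f x v‖ ≤ B := by
  obtain ⟨B, hB⟩ := (hA.prod (isCompact_univ (X := S))).exists_bound_of_continuousOn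
    hf.continuous_grad.continuousOn
  exact ⟨max B 0, le_max_right _ _, fun x hx v => (hB (x, v) ⟨hx, mem_univ _⟩).trans (le_max_left _ _)⟩

variable [PolishSpace S] [MeasurableSpace S] [BorelSpace S]

theorem IsRegularTarget.measurable_grad (hf : IsRegularTarget f) :
    Measurable fun z : ParamSpace K × S => gradTarget f z.1 z.2 :=
  hf.continuous_grad.measurable

theorem IsRegularTarget.measurable_drift (hf : IsRegularTarget f) (ε : ℝ≥0)
    {x : ℝ≥0 → ParamSpace K} (hx : Continuous x) (ω : CadlagPath S) :
    Measurable (drift f ε x ω) :=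
  hf.measurable_grad.comp ((hx.measurable.comp measurable_real_toNNReal).prodMk
    (ω.measurable_coe.comp (measurable_real_toNNReal.div_const ε)))

/-! ### Picard iteration -/

/-- The Picard iterates of the equation in `IsSGPPath`. -/
def picard (f : ParamSpace K → S → ℝ) (ε : ℝ≥0) : ℕ → ParamSpace K → CadlagPath S → ℝ≥0 →
    ParamSpace K
  | 0, m, _, _ => m
  | n + 1, m, ω, t => m - ∫ s in (0 : ℝ)..t, drift f ε (picard f ε n m ω) ω s

theorem measurable_picard (hf : IsRegularTarget f) (ε : ℝ≥0) (n : ℕ) :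
    Measurable fun p : (ParamSpace K × CadlagPath S) × ℝ≥0 => picard f ε n p.1.1 p.1.2 p.2 := by
  induction n with
  | zero => exact measurable_fst.fst
  | succ n ih =>
    have h1 : Measurable fun q : ((ParamSpace K × CadlagPath S) × ℝ≥0) × ℝ =>
        drift f ε (picard f ε n q.1.1.1 q.1.1.2) q.1.1.2 q.2 := by
      refine hf.measurable_grad.comp (Measurable.prodMk ?_ ?_)
      · exact ih.comp (measurable_fst.fst.prodMk measurable_snd.real_toNNReal)
      · exact measurable_cadlagPath_uncurry.comp
          ((measurable_snd.real_toNNReal.div_const ε).prodMk measurable_fst.fst.snd)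
    have h2 : MeasurableSet {q : ((ParamSpace K × CadlagPath S) × ℝ≥0) × ℝ |
        q.2 ∈ Ioc 0 (q.1.2 : ℝ)} :=
      (measurableSet_lt measurable_const measurable_snd).inter
        (measurableSet_le measurable_snd measurable_fst.snd.coe_nnreal_real)
    -- The variable endpoint is moved into an indicator, so that the integral is against a fixed
    -- measure and depends measurably on the parameters.
    have h3 := (StronglyMeasurable.integral_prod_right (ν := (volume : Measure ℝ))
      (f := fun p s => {q : ((ParamSpace K × CadlagPath S) × ℝ≥0) × ℝ |
        q.2 ∈ Ioc 0 (q.1.2 : ℝ)}.indicator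
        (fun q => drift f ε (picard f ε n q.1.1.1 q.1.1.2) q.1.1.2 q.2) (p, s))
      (h1.indicator h2).stronglyMeasurable).measurable
    refine measurable_fst.fst.sub ?_
    convert h3 using 2 with p
    rw [intervalIntegral.integral_of_le p.2.coe_nonneg, ← integral_indicator measurableSet_Ioc]
    rfl

variable [CompactSpace S]

theorem IsRegularTarget.intervalIntegrable_drift (hf : IsRegularTarget f) (ε : ℝ≥0)
    {x : ℝ≥0 → ParamSpace K} (hx : Continuous x) (ω : CadlagPath S) (a b : ℝ) :
    IntervalIntegrable (drift f ε x ω) volume a b := by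
  obtain ⟨B, -, hB⟩ := hf.exists_bound
    ((isCompact_uIcc (a := a) (b := b)).image (f := fun r : ℝ => x r.toNNReal) (by fun_prop))
  refine (intervalIntegrable_const (c := B)).mono_fun
    (hf.measurable_drift ε hx ω).aestronglyMeasurable ?_
  refine (ae_restrict_iff' measurableSet_uIoc).2 (Eventually.of_forall fun s hs => ?_)
  exact (hB _ ⟨s, uIoc_subset_uIcc hs, rfl⟩ _).trans (Real.le_norm_self B)

/-- The index path may jump, so only right derivatives are available; they suffice for the
differential inequalities below. -/
theorem IsRegularTarget.isSGPPath_hasDerivWithinAt (hf : IsRegularTarget f) {ε : ℝ≥0}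
    {m : ParamSpace K} {ω : CadlagPath S} {x : ℝ≥0 → ParamSpace K} (hx : IsSGPPath f ε m ω x)
    {s : ℝ} (hs : 0 ≤ s) :
    HasDerivWithinAt (fun r : ℝ => x r.toNNReal) (-drift f ε x ω s) (Ici s) s := by
  have h1 : HasDerivWithinAt (fun r : ℝ => m - ∫ u in (0 : ℝ)..r, drift f ε x ω u)
      (-drift f ε x ω s) (Ici s) s :=
    (intervalIntegral.integral_hasDerivWithinAt_right
      (hf.intervalIntegrable_drift ε hx.1 ω 0 s) (t := Ioi s)
      (hf.measurable_drift ε hx.1 ω).stronglyMeasurable.stronglyMeasurableAtFilter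
      ((hf.continuousWithinAt_drift ε hx.1 ω s).mono Ioi_subset_Ici_self)).const_sub m
  refine h1.congr (fun r hr => ?_) ?_
  · rw [hx.2, Real.coe_toNNReal _ (hs.trans hr)]; rfl
  · rw [hx.2, Real.coe_toNNReal _ hs]; rfl

theorem continuous_picard (hf : IsRegularTarget f) (ε : ℝ≥0) (n : ℕ) (m : ParamSpace K)
    (ω : CadlagPath S) : Continuous (picard f ε n m ω) := by
  induction n with
  | zero => exact continuous_const
  | succ n ih =>
    exact continuous_const.sub ((intervalIntegral.continuous_primitive
      (fun a b => hf.intervalIntegrable_drift ε ih ω a b) 0).comp NNReal.continuous_coe)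

/-- In the norm weighted by `exp (-2 L t)` the Picard map contracts by the factor `1 / 2`, whence
the rate `2 L` and the powers of two. Taking `L ≥ 1` lets the weight absorb the factor `t` of the
first increment. -/
theorem exists_norm_picard_succ_sub_le (hf : IsRegularTarget f) (ε : ℝ≥0) (m : ParamSpace K)
    (ω : CadlagPath S) : ∃ B L : ℝ, 0 ≤ B ∧ ∀ n t,
      ‖picard f ε (n + 1) m ω t - picard f ε n m ω t‖ ≤ B * Real.exp (L * t) / 2 ^ n := by
  obtain ⟨L, hL1, hL⟩ := hf.exists_lipschitz
  obtain ⟨B, hB0, hB⟩ := hf.exists_bound (isCompact_singleton (x := m))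
  refine ⟨B, 2 * L, hB0, fun n => ?_⟩
  induction n with
  | zero =>
    intro t
    have h1 : ‖∫ s in (0 : ℝ)..t, drift f ε (picard f ε 0 m ω) ω s‖ ≤ B * |(t : ℝ) - 0| :=
      intervalIntegral.norm_integral_le_of_norm_le_const fun s _ => hB m rfl _
    have h2 : (t : ℝ) ≤ Real.exp (2 * L * t) := by
      have := Real.add_one_le_exp (2 * L * t)
      nlinarith [t.coe_nonneg]
    rw [sub_zero, abs_of_nonneg t.coe_nonneg] at h1
    simp only [picard, pow_zero, div_one, sub_sub_cancel_left, norm_neg]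
    exact h1.trans (by gcongr)
  | succ n ih =>
    intro t
    have hi := fun n => hf.intervalIntegrable_drift ε (continuous_picard hf ε n m ω) ω 0 t
    have h0 : picard f ε (n + 1 + 1) m ω t - picard f ε (n + 1) m ω t =
        -∫ s in (0 : ℝ)..t, (drift f ε (picard f ε (n + 1) m ω) ω s
          - drift f ε (picard f ε n m ω) ω s) := by
      rw [intervalIntegral.integral_sub (hi _) (hi _)]
      simp only [picard]
      abel
    have h1 : ‖∫ s in (0 : ℝ)..t, (drift f ε (picard f ε (n + 1) m ω) ω s
          - drift f ε (picard f ε n m ω) ω s)‖ ≤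
        ∫ s in (0 : ℝ)..t, B / 2 ^ (n + 1) * (2 * L * Real.exp (2 * L * s)) := by
      refine intervalIntegral.norm_integral_le_of_norm_le t.coe_nonneg (Eventually.of_forall fun s hs => ?_)
        (Continuous.intervalIntegrable (by fun_prop) _ _)
      refine (hL _ _ _).trans ?_
      have := ih s.toNNReal
      rw [Real.coe_toNNReal _ hs.1.le] at this
      calc _ ≤ L * (B * Real.exp (2 * L * s) / 2 ^ n) := by gcongr
        _ = _ := by rw [pow_succ]; field_simp
    have h2 : ∫ s in (0 : ℝ)..t, 2 * L * Real.exp (2 * L * s) = Real.exp (2 * L * t) - 1 := by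
      rw [intervalIntegral.integral_eq_sub_of_hasDerivAt (f := fun s => Real.exp (2 * L * s))]
      · simp
      · intro s _
        simpa [mul_comm] using ((hasDerivAt_id s).const_mul (2 * L)).exp
      · exact Continuous.intervalIntegrable (by fun_prop) _ _
    rw [intervalIntegral.integral_const_mul, h2] at h1
    rw [h0, norm_neg]
    refine h1.trans ?_
    rw [mul_div_right_comm]
    gcongr
    linarith

/-- The limit of the Picard iterates. -/
def picardLim (f : ParamSpace K → S → ℝ) (ε : ℝ≥0) (m : ParamSpace K) (ω : CadlagPath S)
    (t : ℝ≥0) : ParamSpace K :=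
  limUnder atTop fun n => picard f ε n m ω t

theorem exists_norm_picard_sub_le (hf : IsRegularTarget f) (ε : ℝ≥0) (m : ParamSpace K)
    (ω : CadlagPath S) : ∃ B L : ℝ, 0 ≤ B ∧ 0 ≤ L ∧ ∀ n t,
      ‖picard f ε n m ω t - picardLim f ε m ω t‖ ≤ B * Real.exp (L * t) / 2 ^ n := by
  obtain ⟨B, L, hB, h⟩ := exists_norm_picard_succ_sub_le hf ε m ω
  refine ⟨2 * B, max L 0, by positivity, le_max_right _ _, fun n t => ?_⟩
  have h1 : ∀ n, dist (picard f ε n m ω t) (picard f ε (n + 1) m ω t) ≤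
      2 * B * Real.exp (max L 0 * t) / 2 / 2 ^ n := fun n => by
    rw [dist_comm, dist_eq_norm]
    refine (h n t).trans ?_
    rw [mul_assoc, mul_div_cancel_left₀ _ two_ne_zero]
    gcongr
    exact le_max_left _ _
  rw [← dist_eq_norm]
  exact dist_le_of_le_geometric_two_of_tendsto h1
    (cauchySeq_of_le_geometric_two h1 : CauchySeq _).tendsto_limUnder n

theorem tendsto_picard (hf : IsRegularTarget f) (ε : ℝ≥0) (m : ParamSpace K) (ω : CadlagPath S)
    (t : ℝ≥0) : Tendsto (fun n => picard f ε n m ω t) atTop (𝓝 (picardLim f ε m ω t)) := by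
  obtain ⟨B, L, -, -, h⟩ := exists_norm_picard_sub_le hf ε m ω
  rw [tendsto_iff_norm_sub_tendsto_zero]
  refine squeeze_zero (fun _ => norm_nonneg _) (fun n => h n t) ?_
  exact tendsto_const_nhds.div_atTop (tendsto_pow_atTop_atTop_of_one_lt one_lt_two)

theorem isSGPPath_picardLim (hf : IsRegularTarget f) (ε : ℝ≥0) (m : ParamSpace K)
    (ω : CadlagPath S) : IsSGPPath f ε m ω (picardLim f ε m ω) := by
  obtain ⟨B, L, hB0, hL0, h⟩ := exists_norm_picard_sub_le hf ε m ω
  have hz : ∀ a : ℝ, Tendsto (fun n : ℕ => a / 2 ^ n) atTop (𝓝 0) := fun a =>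
    tendsto_const_nhds.div_atTop (tendsto_pow_atTop_atTop_of_one_lt one_lt_two)
  have hc : Continuous (picardLim f ε m ω) := by
    refine TendstoLocallyUniformly.continuous (F := fun n => picard f ε n m ω) (p := atTop) ?_
      (Eventually.of_forall fun n => continuous_picard hf ε n m ω).frequently
    refine Metric.tendstoLocallyUniformly_iff.2 fun η hη t => ?_
    refine ⟨Iio (t + 1), Iio_mem_nhds (by simp), ?_⟩
    filter_upwards [(hz (B * Real.exp (L * (t + 1)))).eventually_lt_const hη] with n hn s hs
    rw [dist_comm, dist_eq_norm]
    refine (h n s).trans_lt (lt_of_le_of_lt ?_ hn)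
    have : (s : ℝ) ≤ t + 1 := by exact_mod_cast (mem_Iio.1 hs).le
    gcongr
  refine ⟨hc, fun t => ?_⟩
  obtain ⟨M, hM1, hM⟩ := hf.exists_lipschitz
  refine tendsto_nhds_unique ((tendsto_add_atTop_iff_nat 1).2 (tendsto_picard hf ε m ω t)) ?_
  refine tendsto_const_nhds.sub ?_
  rw [tendsto_iff_norm_sub_tendsto_zero]
  refine squeeze_zero (fun _ => norm_nonneg _) (fun n => ?_)
    (hz (M * (B * Real.exp (L * t)) * t))
  change ‖(∫ s in (0 : ℝ)..t, drift f ε (picard f ε n m ω) ω s) -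
    ∫ s in (0 : ℝ)..t, drift f ε (picardLim f ε m ω) ω s‖ ≤ _
  rw [← intervalIntegral.integral_sub
    (hf.intervalIntegrable_drift ε (continuous_picard hf ε n m ω) ω 0 t)
    (hf.intervalIntegrable_drift ε hc ω 0 t)]
  have h1 := intervalIntegral.norm_integral_le_of_norm_le_const (a := (0 : ℝ)) (b := t)
    (C := M * (B * Real.exp (L * t) / 2 ^ n))
    (f := fun s => drift f ε (picard f ε n m ω) ω s - drift f ε (picardLim f ε m ω) ω s)
    fun s hs => by
      rw [uIoc_of_le t.coe_nonneg] at hs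
      refine (hM _ _ _).trans ?_
      gcongr
      refine (h n _).trans ?_
      rw [Real.coe_toNNReal _ hs.1.le]
      gcongr
      exact hs.2
  rw [sub_zero, abs_of_nonneg t.coe_nonneg] at h1
  exact h1.trans_eq (by ring)

/-! ### Contraction, uniqueness and boundedness -/

variable {κ : ℝ}

/-- By strong convexity, `exp (2 κ t) ‖x - x'‖ ^ 2` has nonpositive right derivative. Two index
paths agreeing only before the final time are allowed, so that one estimate yields contraction,
uniqueness and non-anticipation. -/
theorem IsSGPPath.norm_sub_le (hf : IsRegularTarget f) (hconv : IsUniformlyStronglyConvex f κ)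
    {ε : ℝ≥0} {m m' : ParamSpace K} {ω ω' : CadlagPath S} {x x' : ℝ≥0 → ParamSpace K}
    (hx : IsSGPPath f ε m ω x) (hx' : IsSGPPath f ε m' ω' x') {t : ℝ≥0}
    (hω : ∀ s < t, ω (s / ε) = ω' (s / ε)) :
    ‖x t - x' t‖ ≤ Real.exp (-κ * t) * ‖m - m'‖ := by
  have hd : ∀ s ∈ Ico (0 : ℝ) t, HasDerivWithinAt
      (fun r : ℝ => Real.exp (2 * κ * r) * ‖x r.toNNReal - x' r.toNNReal‖ ^ 2)
      (2 * κ * Real.exp (2 * κ * s) * ‖x s.toNNReal - x' s.toNNReal‖ ^ 2 + Real.exp (2 * κ * s) *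
        (2 * inner ℝ (x s.toNNReal - x' s.toNNReal) (-drift f ε x ω s - -drift f ε x' ω' s)))
      (Ici s) s := fun s hs => by
    have h1 := ((hf.isSGPPath_hasDerivWithinAt hx hs.1).sub
      (hf.isSGPPath_hasDerivWithinAt hx' hs.1)).norm_sq
    have h2 : HasDerivAt (fun r : ℝ => Real.exp (2 * κ * r)) (2 * κ * Real.exp (2 * κ * s)) s := by
      simpa [mul_comm] using ((hasDerivAt_id s).const_mul (2 * κ)).exp
    exact h2.hasDerivWithinAt.mul h1
  have hc := hx.1
  have hc' := hx'.1
  have hle := image_le_of_deriv_right_le_deriv_boundary (a := 0) (b := t)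
    (f := fun r : ℝ => Real.exp (2 * κ * r) * ‖x r.toNNReal - x' r.toNNReal‖ ^ 2)
    (Continuous.continuousOn (by fun_prop)) hd (B := fun _ => ‖m - m'‖ ^ 2) (B' := fun _ => 0)
    (by simp [hx.apply_zero, hx'.apply_zero]) continuousOn_const
    (fun s _ => hasDerivWithinAt_const _ _ _) (fun s hs => by
      have h1 := hconv (ω (s.toNNReal / ε)) (x s.toNNReal) (x' s.toNNReal)
      have h2 : ω (s.toNNReal / ε) = ω' (s.toNNReal / ε) :=
        hω _ ((Real.toNNReal_lt_iff_lt_coe hs.1).2 hs.2)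
      have h3 : inner ℝ (x s.toNNReal - x' s.toNNReal) (-drift f ε x ω s - -drift f ε x' ω' s) =
          -inner ℝ (x s.toNNReal - x' s.toNNReal)
            (gradTarget f (x s.toNNReal) (ω (s.toNNReal / ε)) -
              gradTarget f (x' s.toNNReal) (ω (s.toNNReal / ε))) := by
        rw [← inner_neg_right, drift, drift, ← h2]
        congr 1
        abel
      rw [h3]
      nlinarith [Real.exp_pos (2 * κ * s)]) (right_mem_Icc.2 t.coe_nonneg)
  simp only [Real.toNNReal_coe] at hle
  refine le_of_sq_le_sq ?_ (by positivity)
  have h4 : Real.exp (-κ * t) ^ 2 * Real.exp (2 * κ * t) = 1 := by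
    rw [← Real.exp_nat_mul, ← Real.exp_add]
    simp; ring
  calc ‖x t - x' t‖ ^ 2 = Real.exp (-κ * t) ^ 2 * (Real.exp (2 * κ * t) * ‖x t - x' t‖ ^ 2) := by
        rw [← mul_assoc, h4, one_mul]
    _ ≤ Real.exp (-κ * t) ^ 2 * ‖m - m'‖ ^ 2 := by gcongr
    _ = _ := by ring

theorem isSGPPath_sgp (hf : IsRegularTarget f) (ε : ℝ≥0) (m : ParamSpace K) (ω : CadlagPath S) :
    IsSGPPath f ε m ω (sgp f ε m ω) :=
  Classical.epsilon_spec ⟨_, isSGPPath_picardLim hf ε m ω⟩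

theorem IsSGPPath.eq_sgp (hf : IsRegularTarget f) (hconv : IsUniformlyStronglyConvex f κ)
    {ε : ℝ≥0} {m : ParamSpace K} {ω : CadlagPath S} {x : ℝ≥0 → ParamSpace K}
    (hx : IsSGPPath f ε m ω x) : x = sgp f ε m ω := by
  funext t
  have := hx.norm_sub_le hf hconv (isSGPPath_sgp hf ε m ω) (t := t) fun _ _ => rfl
  rw [sub_self, norm_zero, mul_zero] at this
  exact sub_eq_zero.1 (norm_le_zero_iff.1 this)

theorem norm_sgp_sub_sgp_le (hf : IsRegularTarget f) (hconv : IsUniformlyStronglyConvex f κ)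
    (ε : ℝ≥0) (m m' : ParamSpace K) (ω : CadlagPath S) (t : ℝ≥0) :
    ‖sgp f ε m ω t - sgp f ε m' ω t‖ ≤ Real.exp (-κ * t) * ‖m - m'‖ :=
  (isSGPPath_sgp hf ε m ω).norm_sub_le hf hconv (isSGPPath_sgp hf ε m' ω) fun _ _ => rfl

theorem sgp_congr (hf : IsRegularTarget f) (hconv : IsUniformlyStronglyConvex f κ)
    (ε : ℝ≥0) (m : ParamSpace K) {ω ω' : CadlagPath S} {t : ℝ≥0}
    (h : ∀ s ≤ t / ε, ω s = ω' s) : sgp f ε m ω t = sgp f ε m ω' t := by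
  have := (isSGPPath_sgp hf ε m ω).norm_sub_le hf hconv (isSGPPath_sgp hf ε m ω') (t := t)
    fun s hs => h _ (by gcongr)
  rw [sub_self, norm_zero, mul_zero] at this
  exact sub_eq_zero.1 (norm_le_zero_iff.1 this)

/-- The solution is defined by choice, so measurability comes from uniqueness, which identifies it
with the pointwise limit of the Picard iterates. -/
theorem measurable_sgp (hf : IsRegularTarget f) (hconv : IsUniformlyStronglyConvex f κ)
    (ε t : ℝ≥0) :
    Measurable fun p : ParamSpace K × CadlagPath S => sgp f ε p.1 p.2 t := by
  refine measurable_of_tendsto_metrizable (f := fun n p => picard f ε n p.1 p.2 t)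
    (fun n => ?_)
    (tendsto_pi_nhds.2 fun p => ?_)
  · exact (measurable_picard hf ε n).comp (measurable_id.prodMk (measurable_const (a := t)))
  rw [← (isSGPPath_picardLim hf ε p.1 p.2).eq_sgp hf hconv]
  exact tendsto_picard hf ε p.1 p.2 t

/-- With `b = B / κ`, convexity between `x` and `0` bounds the right derivative of `exp (κ t) (‖x‖ ^
2 - b ^ 2)` by `-κ (‖x‖ - b) ^ 2 exp (κ t)`, which is nonpositive. -/
theorem norm_sgp_le (hf : IsRegularTarget f) (hconv : IsUniformlyStronglyConvex f κ) (hκ : 0 < κ)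
    {B : ℝ} (hB : ∀ v, ‖gradTarget f 0 v‖ ≤ B) (ε : ℝ≥0) (m : ParamSpace K) (ω : CadlagPath S)
    (t : ℝ≥0) : ‖sgp f ε m ω t‖ ≤ ‖m‖ + B / κ := by
  have hB0 : 0 ≤ B := (norm_nonneg _).trans (hB (ω 0))
  set x := sgp f ε m ω with hxdef
  have hx : IsSGPPath f ε m ω x := isSGPPath_sgp hf ε m ω
  have hd : ∀ s ∈ Ico (0 : ℝ) t, HasDerivWithinAt
      (fun r : ℝ => Real.exp (κ * r) * (‖x r.toNNReal‖ ^ 2 - (B / κ) ^ 2))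
      (κ * Real.exp (κ * s) * (‖x s.toNNReal‖ ^ 2 - (B / κ) ^ 2) + Real.exp (κ * s) *
        (2 * inner ℝ (x s.toNNReal) (-drift f ε x ω s))) (Ici s) s := fun s hs => by
    have h1 := (hf.isSGPPath_hasDerivWithinAt hx hs.1).norm_sq.sub_const ((B / κ) ^ 2)
    have h2 : HasDerivAt (fun r : ℝ => Real.exp (κ * r)) (κ * Real.exp (κ * s)) s := by
      simpa [mul_comm] using ((hasDerivAt_id s).const_mul κ).exp
    exact h2.hasDerivWithinAt.mul h1
  have hc := hx.1
  have hle := image_le_of_deriv_right_le_deriv_boundary (a := 0) (b := t)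
    (f := fun r : ℝ => Real.exp (κ * r) * (‖x r.toNNReal‖ ^ 2 - (B / κ) ^ 2))
    (Continuous.continuousOn (by fun_prop)) hd (B := fun _ => ‖m‖ ^ 2) (B' := fun _ => 0)
    (by simp [hx.apply_zero]; positivity) continuousOn_const
    (fun s _ => hasDerivWithinAt_const _ _ _) (fun s hs => by
      have h1 := hconv (ω (s.toNNReal / ε)) (x s.toNNReal) 0
      rw [sub_zero, inner_sub_right] at h1
      have h2 := neg_le_of_abs_le (abs_real_inner_le_norm (x s.toNNReal)
        (gradTarget f 0 (ω (s.toNNReal / ε))))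
      have h3 : ‖x s.toNNReal‖ * ‖gradTarget f 0 (ω (s.toNNReal / ε))‖ ≤ ‖x s.toNNReal‖ * B := by
        gcongr
        exact hB _
      have h4 : κ * (‖x s.toNNReal‖ ^ 2 - (B / κ) ^ 2) +
          2 * inner ℝ (x s.toNNReal) (-drift f ε x ω s) ≤ 0 := by
        have h5 : κ * (B / κ) = B := by field_simp
        rw [inner_neg_right, drift]
        generalize B / κ = b at *
        subst h5
        have h6 : 0 ≤ κ * (‖x s.toNNReal‖ - b) ^ 2 := by positivity
        nlinarith
      nlinarith [Real.exp_pos (κ * s)]) (right_mem_Icc.2 t.coe_nonneg)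
  simp only [Real.toNNReal_coe] at hle
  have hb : 0 ≤ B / κ := by positivity
  have h1 : 1 ≤ Real.exp (κ * t) := Real.one_le_exp (by positivity)
  have h2 : ‖x t‖ ^ 2 - (B / κ) ^ 2 ≤ ‖m‖ ^ 2 := by
    by_contra! h
    nlinarith [sq_nonneg ‖m‖]
  refine le_of_sq_le_sq ?_ (by positivity)
  nlinarith [norm_nonneg m]

/-- The cocycle property: the restarted solution solves the equation along the shifted path, and
solutions are unique. -/
theorem sgp_add (hf : IsRegularTarget f) (hconv : IsUniformlyStronglyConvex f κ)
    (ε : ℝ≥0) (m : ParamSpace K) (ω : CadlagPath S) (s t : ℝ≥0) :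
    sgp f ε m ω (s + t) = sgp f ε (sgp f ε m ω s) (ω.shift (s / ε)) t := by
  have hx := isSGPPath_sgp hf ε m ω
  have hc := hx.1
  refine congr_fun (IsSGPPath.eq_sgp hf hconv (x := fun t => sgp f ε m ω (s + t)) ?_) t
  refine ⟨by fun_prop, fun t => ?_⟩
  have hi := fun a b => hf.intervalIntegrable_drift ε hc ω a b
  have h1 : ∫ r in (0 : ℝ)..t, gradTarget f (sgp f ε m ω (s + r.toNNReal))
      (ω.shift (s / ε) (r.toNNReal / ε)) = ∫ r in (0 : ℝ)..t, drift f ε (sgp f ε m ω) ω (s + r) := by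
    refine intervalIntegral.integral_congr fun r hr => ?_
    rw [uIcc_of_le t.coe_nonneg] at hr
    simp only [drift]
    rw [Real.toNNReal_add s.coe_nonneg hr.1, Real.toNNReal_coe, CadlagPath.shift_apply, add_div]
  have h2 : ∫ r in (0 : ℝ)..(s + t : ℝ≥0), drift f ε (sgp f ε m ω) ω r =
      (∫ r in (0 : ℝ)..s, drift f ε (sgp f ε m ω) ω r) +
        ∫ r in (0 : ℝ)..t, drift f ε (sgp f ε m ω) ω (s + r) := by
    rw [intervalIntegral.integral_comp_add_left (fun r => drift f ε (sgp f ε m ω) ω r), add_zero,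
      NNReal.coe_add]
    exact (intervalIntegral.integral_add_adjacent_intervals (hi _ _) (hi _ _)).symm
  have h3 : sgp f ε m ω s = m - ∫ r in (0 : ℝ)..s, drift f ε (sgp f ε m ω) ω r := hx.2 s
  calc sgp f ε m ω (s + t) = m - ∫ r in (0 : ℝ)..(s + t : ℝ≥0), drift f ε (sgp f ε m ω) ω r :=
        hx.2 (s + t)
    _ = sgp f ε m ω s - ∫ r in (0 : ℝ)..t, drift f ε (sgp f ε m ω) ω (s + r) := by
        rw [h2, h3, sub_sub]
    _ = _ := by rw [← h1]

end Equation

/-! ### The Markov property on path space -/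

theorem setLIntegral_inter_preimage {Ω α : Type*} {mΩ : MeasurableSpace Ω} [MeasurableSpace α]
    (ν : Measure Ω) (D : Set Ω) {Y : Ω → α} (hY : Measurable Y) {A : Set α} (hA : MeasurableSet A)
    (g : α → ℝ≥0∞) : ∫⁻ ω in D ∩ Y ⁻¹' A, g (Y ω) ∂ν = ∫⁻ ω in D, A.indicator g (Y ω) ∂ν := by
  rw [inter_comm, ← setLIntegral_indicator (hY hA)]
  rfl

section Markov

variable {S : Type u} [MeasurableSpace S]

theorem IsMarkovWith.setLIntegral_eq {Ω : Type v} {mΩ : MeasurableSpace Ω}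
    {𝒢 : Filtration ℝ≥0 mΩ} {μ : Measure Ω} {p : ℝ≥0 → Kernel S S} {X : ℝ≥0 → Ω → S}
    (hX : IsMarkovWith 𝒢 μ p X) (s t : ℝ≥0) {B : Set Ω} (hB : MeasurableSet[𝒢 s] B)
    {h : S → ℝ≥0∞} (hh : Measurable h) :
    ∫⁻ ω in B, h (X (s + t) ω) ∂μ = ∫⁻ ω in B, ∫⁻ y, h y ∂(p t (X s ω)) ∂μ := by
  have hm : ∀ t, Measurable (X t) := fun t => (hX.1 t).mono (𝒢.le t) le_rfl
  have key : (μ.restrict B).map (X (s + t)) = ((μ.restrict B).map (X s)).bind (p t) := by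
    ext A hA
    rw [Measure.map_apply (hm _) hA, Measure.restrict_apply (hm _ hA), inter_comm,
      hX.2 s t A B hA hB, Measure.bind_apply hA (p t).aemeasurable,
      lintegral_map ((p t).measurable_coe hA) (hm s)]
  rw [← lintegral_map hh (hm _), key, Measure.lintegral_bind (p t).aemeasurable hh.aemeasurable,
    lintegral_map hh.lintegral_kernel (hm s)]

variable [TopologicalSpace S] {P : Kernel S (CadlagPath S)}

theorem transition_apply' (P : Kernel S (CadlagPath S)) (t : ℝ≥0) (x : S) :
    transition P t x = (P x).map fun ω => ω t :=
  Kernel.map_apply _ (CadlagPath.measurable_eval t) _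

theorem lintegral_transition (P : Kernel S (CadlagPath S)) (t : ℝ≥0) (x : S) {h : S → ℝ≥0∞}
    (hh : Measurable h) : ∫⁻ y, h y ∂(transition P t x) = ∫⁻ ω, h (ω t) ∂(P x) := by
  rw [transition_apply', lintegral_map hh (CadlagPath.measurable_eval t)]

variable {Ω : Type v} {mΩ : MeasurableSpace Ω} {𝒢 : Filtration ℝ≥0 mΩ} {μ : Measure Ω}
  {X : Ω → CadlagPath S}

/-- Induction on the largest time. The free function `h` at a later time `r` carries the induction:
conditioning at the largest time `a` replaces it by its transition mean, cut off to `A a`. -/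
theorem IsMarkovWith.setLIntegral_cylinder (hP : IsFellerProcess P)
    (hX : IsMarkovWith 𝒢 μ (transition P) fun t ω => X ω t) (s : ℝ≥0) {B : Set Ω}
    (hB : MeasurableSet[𝒢 s] B) {A : ℝ≥0 → Set S} (hA : ∀ t, MeasurableSet (A t))
    (I : Finset ℝ≥0) : ∀ (r : ℝ≥0), (∀ t ∈ I, t ≤ r) → ∀ h : S → ℝ≥0∞, Measurable h →
    ∫⁻ ω in B ∩ ⋂ t ∈ I, (fun ω => X ω (s + t)) ⁻¹' A t, h (X ω (s + r)) ∂μ =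
      ∫⁻ ω in B, ∫⁻ w in ⋂ t ∈ I, (fun w : CadlagPath S => w t) ⁻¹' A t, h (w r) ∂(P (X ω s)) ∂μ := by
  induction I using Finset.induction_on_max with
  | empty =>
    intro r _ h hh
    simp only [Finset.notMem_empty, iInter_of_empty, iInter_univ, inter_univ, Measure.restrict_univ]
    rw [hX.setLIntegral_eq s r hB hh]
    simp_rw [lintegral_transition P r _ hh]
  | insert a I ha ih =>
    intro r hr h hh
    have har : a ≤ r := hr a (Finset.mem_insert_self a I)
    have hg : Measurable fun y => ∫⁻ z, h z ∂(transition P (r - a) y) := hh.lintegral_kernel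
    have hC : MeasurableSet[𝒢 (s + a)]
        ((B ∩ ⋂ t ∈ I, (fun ω => X ω (s + t)) ⁻¹' A t) ∩ (fun ω => X ω (s + a)) ⁻¹' A a) := by
      refine MeasurableSet.inter (MeasurableSet.inter (𝒢.mono (by simp) _ hB) ?_) (hX.1 _ (hA a))
      exact Finset.measurableSet_biInter _ fun t ht =>
        𝒢.mono (add_le_add_right (ha t ht).le s) _ (hX.1 (s + t) (hA t))
    have hC' : MeasurableSet[canonicalFiltration S a]
        ((⋂ t ∈ I, (fun w : CadlagPath S => w t) ⁻¹' A t) ∩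
          (fun w : CadlagPath S => w a) ⁻¹' A a) := by
      have hm : ∀ t ≤ a, Measurable[canonicalFiltration S a] fun w : CadlagPath S => w t :=
        fun t ht => measurable_iff_comap_le.2 (le_iSup (fun s : {s : ℝ≥0 // s ≤ a} =>
          MeasurableSpace.comap (fun ω : CadlagPath S => ω s.1) inferInstance) ⟨t, ht⟩)
      exact (Finset.measurableSet_biInter _ fun t ht => hm t (ha t ht).le (hA t)).inter
        (hm a le_rfl (hA a))
    have hr' : s + r = (s + a) + (r - a) := by rw [add_assoc, add_tsub_cancel_of_le har]
    rw [Finset.set_biInter_insert, Finset.set_biInter_insert, inter_comm (_ ⁻¹' A a),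
      inter_comm (_ ⁻¹' A a), ← inter_assoc, hr', hX.setLIntegral_eq (s + a) (r - a) hC hh]
    have hXa : Measurable fun ω => X ω (s + a) := (hX.1 (s + a)).mono (𝒢.le _) le_rfl
    refine (setLIntegral_inter_preimage μ _ hXa (hA a) fun y =>
      ∫⁻ z, h z ∂(transition P (r - a) y)).trans ?_
    refine (ih a (fun t ht => (ha t ht).le) _ (hg.indicator (hA a))).trans ?_
    refine lintegral_congr fun ω => ?_
    have := (hP.markov (X ω s)).setLIntegral_eq a (r - a) hC' hh
    rw [add_tsub_cancel_of_le har] at this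
    rw [this]
    exact (setLIntegral_inter_preimage _ _ (CadlagPath.measurable_eval a) (hA a) fun y =>
      ∫⁻ z, h z ∂(transition P (r - a) y)).symm

/-- The Markov property for the whole future of the path. -/
theorem IsMarkovWith.map_shift [IsFiniteMeasure μ] (hP : IsFellerProcess P) (hXm : Measurable X)
    (hX : IsMarkovWith 𝒢 μ (transition P) fun t ω => X ω t) (s : ℝ≥0) {B : Set Ω}
    (hB : MeasurableSet[𝒢 s] B) :
    (μ.restrict B).map (fun ω => (X ω).shift s) =
      ((μ.restrict B).map fun ω => X ω s).bind P := by
  have := hP.isProbability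
  have : IsMarkovKernel P := ⟨hP.isProbability⟩
  have hXs : Measurable fun ω => X ω s := (CadlagPath.measurable_eval s).comp hXm
  have hsh : Measurable fun ω => (X ω).shift s := (CadlagPath.measurable_shift s).comp hXm
  have hgen := generateFrom_piiUnionInter_measurableSet
    (fun t : ℝ≥0 => MeasurableSpace.comap (fun ω : CadlagPath S => ω t) inferInstance) univ
  simp only [mem_univ, iSup_pos] at hgen
  refine ext_of_generate_finite _ hgen.symm (isPiSystem_piiUnionInter _ (fun t =>
    @MeasurableSpace.isPiSystem_measurableSet _ (MeasurableSpace.comap _ _)) _) ?_ ?_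
  · rintro E ⟨I, -, g, hg, rfl⟩
    choose! A hA hAg using hg
    have hA' : ∀ t, MeasurableSet (if t ∈ I then A t else univ) := fun t => by
      split_ifs with h
      exacts [hA t h, MeasurableSet.univ]
    have hE : ⋂ t ∈ I, g t = ⋂ t ∈ I, (fun w : CadlagPath S => w t) ⁻¹' (if t ∈ I then A t else univ) :=
      iInter₂_congr fun t ht => by rw [if_pos ht, hAg t ht]
    have hEm : MeasurableSet (⋂ t ∈ I, g t) := hE ▸ Finset.measurableSet_biInter _ fun t _ =>
      CadlagPath.measurable_eval t (hA' t)
    rw [Measure.map_apply hsh hEm, Measure.restrict_apply (hsh hEm), inter_comm,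
      Measure.bind_apply hEm P.aemeasurable, lintegral_map (P.measurable_coe hEm) hXs]
    -- With `h = 1` the final time is irrelevant; any bound of `I` will do.
    have key := hX.setLIntegral_cylinder hP s hB hA' I (I.sup id) (fun t ht => Finset.le_sup (f := id) ht)
      (fun _ => 1) measurable_const
    simp only [setLIntegral_one, ← hE] at key
    rw [← key, hE]
    simp only [preimage_iInter]
    rfl
  · rw [Measure.map_apply hsh .univ, Measure.bind_apply .univ P.aemeasurable]
    simp [Measure.map_apply hXs]

/-- The Markov identity is linear in the law, so it may be integrated over the starting point. -/
theorem lawFrom_isMarkovWith (hP : IsFellerProcess P) (π : Measure S) :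
    IsMarkovWith (canonicalFiltration S) (lawFrom P π) (transition P) fun t ω => ω t := by
  refine ⟨fun t => measurable_iff_comap_le.2 (le_iSup (fun s : {s : ℝ≥0 // s ≤ t} =>
    MeasurableSpace.comap (fun ω : CadlagPath S => ω s.1) inferInstance) ⟨t, le_rfl⟩), ?_⟩
  intro s t A B hA hB
  have hB' := (canonicalFiltration S).le s _ hB
  have hm : Measurable fun ω : CadlagPath S => transition P t (ω s) A :=
    ((transition P t).measurable_coe hA).comp (CadlagPath.measurable_eval s)
  rw [lawFrom, Measure.bind_apply (hB'.inter (CadlagPath.measurable_eval _ hA)) P.aemeasurable,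
    ← lintegral_indicator hB', Measure.lintegral_bind P.aemeasurable (hm.indicator hB').aemeasurable]
  refine lintegral_congr fun x => ?_
  rw [(hP.markov x).2 s t A B hA hB, lintegral_indicator hB']

instance {π : Measure S} [IsProbabilityMeasure π] [IsMarkovKernel P] :
    IsProbabilityMeasure (lawFrom P π) := by
  unfold lawFrom; infer_instance

theorem lawFrom_map_eval (P : Kernel S (CadlagPath S)) (π : Measure S) (t : ℝ≥0) :
    (lawFrom P π).map (fun ω => ω t) = π.bind (transition P t) := by
  ext A hA
  rw [Measure.map_apply (CadlagPath.measurable_eval t) hA, lawFrom,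
    Measure.bind_apply (CadlagPath.measurable_eval t hA) P.aemeasurable,
    Measure.bind_apply hA (transition P t).aemeasurable]
  refine lintegral_congr fun x => ?_
  rw [transition_apply', Measure.map_apply (CadlagPath.measurable_eval t) hA]

/-- Invariance concerns single times; the Markov property upgrades it to shift invariance of the law
of the whole path. -/
theorem IsInvariantLaw.lawFrom_map_shift (hP : IsFellerProcess P) {π : Measure S}
    (hπ : IsInvariantLaw P π) (s : ℝ≥0) :
    (lawFrom P π).map (CadlagPath.shift s) = lawFrom P π := by
  have := hπ.1
  have : IsMarkovKernel P := ⟨hP.isProbability⟩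
  have h := (lawFrom_isMarkovWith hP π).map_shift (X := id) hP measurable_id s MeasurableSet.univ
  rw [Measure.restrict_univ] at h
  refine h.trans ?_
  have h2 := lawFrom_map_eval P π s
  rw [hπ.2 s] at h2
  exact congrArg (fun ν : Measure S => ν.bind P) h2

/-- The law of a Markov process is determined by its initial distribution. -/
theorem IsMarkovWith.map_eq_lawFrom [IsFiniteMeasure μ] (hP : IsFellerProcess P)
    (hXm : Measurable X) (hX : IsMarkovWith 𝒢 μ (transition P) fun t ω => X ω t) :
    μ.map X = lawFrom P (μ.map fun ω => X ω 0) := by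
  have h := hX.map_shift hP hXm 0 MeasurableSet.univ
  have h0 : (fun ω => (X ω).shift 0) = X :=
    funext fun ω => Subtype.ext (funext fun t => by simp [CadlagPath.shift])
  rwa [Measure.restrict_univ, h0] at h

end Markov

/-! ### The strong Markov property at a meeting time -/

theorem integral_bind_kernel {α β : Type*} {mα : MeasurableSpace α} {mβ : MeasurableSpace β}
    (μ : Measure α) [IsFiniteMeasure μ] (p : Kernel α β) [IsFiniteKernel p] {g : β → ℝ}
    (hg : Integrable g (μ.bind p)) : ∫ y, g y ∂(μ.bind p) = ∫ x, ∫ y, g y ∂(p x) ∂μ := by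
  have h : (p ∘ₖ Kernel.const Unit μ) () = μ.bind p := by rw [Kernel.comp_apply, Kernel.const_apply]
  rw [← h] at hg ⊢
  rw [Kernel.integral_comp hg, Kernel.const_apply]

theorem Integrable.of_measurable_of_abs_le {α : Type*} {mα : MeasurableSpace α} {μ : Measure α}
    [IsFiniteMeasure μ] {g : α → ℝ} (hg : Measurable g) {c : ℝ} (hc : ∀ x, |g x| ≤ c) :
    Integrable g μ :=
  Integrable.of_bound hg.aestronglyMeasurable c (Eventually.of_forall hc)

section StrongMarkov

variable {S : Type u} [TopologicalSpace S] [PolishSpace S]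
  [MeasurableSpace S] [BorelSpace S]

/-- The occupation integral `∫₀ᶜ h(w_u) du`. -/
def occupation (h : C(S, ℝ)) (c : ℝ) (w : CadlagPath S) : ℝ := ∫ u in (0 : ℝ)..c, h (w u.toNNReal)

variable (h : C(S, ℝ))

theorem measurable_comp_path (w : CadlagPath S) : Measurable fun u : ℝ => h (w u.toNNReal) :=
  h.continuous.measurable.comp (w.measurable_coe.comp measurable_real_toNNReal)

theorem measurable_occupation (c : ℝ) : Measurable (occupation h c) := by
  have h1 : Measurable fun p : CadlagPath S × ℝ => h (p.1 p.2.toNNReal) :=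
    h.continuous.measurable.comp (measurable_cadlagPath_uncurry.comp
      (measurable_snd.real_toNNReal.prodMk measurable_fst))
  have h2 := fun a b => (StronglyMeasurable.integral_prod_right
    (ν := (volume : Measure ℝ).restrict (Ioc a b)) (f := fun (w : CadlagPath S) u => h (w u.toNNReal))
    h1.stronglyMeasurable).measurable
  -- An interval integral is by definition the difference of the integrals over `Ioc 0 c` and `Ioc c
  -- 0`, one of which is empty.
  exact (h2 0 c).sub (h2 c 0)

variable [CompactSpace S]

theorem intervalIntegrable_comp_path (w : CadlagPath S) (a b : ℝ) :
    IntervalIntegrable (fun u : ℝ => h (w u.toNNReal)) volume a b :=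
  (intervalIntegrable_const (c := ‖h‖)).mono_fun (measurable_comp_path h w).aestronglyMeasurable
    (Eventually.of_forall fun _ => (h.norm_coe_le_norm _).trans (Real.le_norm_self _))

theorem lipschitzWith_occupation (w : CadlagPath S) :
    LipschitzWith ‖h‖₊ fun c => occupation h c w := by
  refine LipschitzWith.of_dist_le_mul fun c c' => ?_
  rw [Real.dist_eq, Real.dist_eq, occupation, occupation,
    intervalIntegral.integral_interval_sub_left (intervalIntegrable_comp_path h w _ _)
      (intervalIntegrable_comp_path h w _ _)]
  exact intervalIntegral.norm_integral_le_of_norm_le_const fun u _ => h.norm_coe_le_norm _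

theorem abs_occupation_le (c : ℝ) (w : CadlagPath S) : |occupation h c w| ≤ ‖h‖ * |c| := by
  simpa [occupation] using (lipschitzWith_occupation h w).dist_le_mul c 0

theorem occupation_shift (w : CadlagPath S) (g : ℝ≥0) {c : ℝ} (hc : 0 ≤ c) :
    occupation h c (w.shift g) = occupation h (g + c) w - occupation h g w := by
  have h1 : occupation h c (w.shift g) = ∫ u in (0 : ℝ)..c, h (w ((g : ℝ) + u).toNNReal) := by
    refine intervalIntegral.integral_congr fun u hu => ?_
    rw [uIcc_of_le hc] at hu
    simp only [CadlagPath.shift_apply]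
    rw [Real.toNNReal_add g.coe_nonneg hu.1, Real.toNNReal_coe]
  rw [h1, intervalIntegral.integral_comp_add_left (fun u => h (w u.toNNReal)), add_zero, occupation,
    occupation, intervalIntegral.integral_interval_sub_left (intervalIntegrable_comp_path h w _ _)
      (intervalIntegrable_comp_path h w _ _)]

variable {P : Kernel S (CadlagPath S)}

/-- The integrated semigroup `𝔼_x ∫₀ᶜ h(V_u) du`. -/
def occupationMean (P : Kernel S (CadlagPath S)) (h : C(S, ℝ)) (c : ℝ) (x : S) : ℝ :=
  ∫ w, occupation h c w ∂(P x)

theorem integrable_occupation (hP : IsFellerProcess P) (c : ℝ) (x : S) :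
    Integrable (occupation h c) (P x) :=
  have := hP.isProbability x
  Integrable.of_measurable_of_abs_le (measurable_occupation h c) (abs_occupation_le h c)

theorem abs_occupationMean_le (hP : IsFellerProcess P) (c : ℝ) (x : S) :
    |occupationMean P h c x| ≤ ‖h‖ * |c| := by
  have := hP.isProbability x
  have h1 : |∫ w, occupation h c w ∂(P x)| ≤ ‖h‖ * |c| := by
    simpa using norm_integral_le_of_norm_le_const (μ := P x)
      (f := occupation h c) (Eventually.of_forall fun w => abs_occupation_le h c w)
  exact h1

/-- This is the reason for integrating in time. The Feller property gives continuity in `x` at a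
fixed time only; the integrated mean is moreover Lipschitz in `c` uniformly in `x`, hence jointly
continuous. Joint continuity is needed when time and state vary together near the meeting time. -/
theorem continuous_occupationMean (hP : IsFellerProcess P) :
    Continuous fun p : ℝ × S => occupationMean P h p.1 p.2 := by
  refine continuous_prod_of_continuous_lipschitzWith _ ‖h‖₊ (fun c => ?_) fun x => ?_
  · have h1 : ∀ x, occupationMean P h c x = ∫ u in (0 : ℝ)..c, ∫ w, h (w u.toNNReal) ∂(P x) := by
      intro x
      have := hP.isProbability x
      have : IsFiniteMeasure ((volume : Measure ℝ).restrict (uIoc 0 c)) :=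
        ⟨by rw [Measure.restrict_apply_univ, uIoc]; exact measure_Ioc_lt_top⟩
      symm
      refine intervalIntegral_integral_swap (Integrable.of_bound
        (Measurable.aestronglyMeasurable ?_) ‖h‖ (Eventually.of_forall fun _ => h.norm_coe_le_norm _))
      exact h.continuous.measurable.comp (measurable_cadlagPath_uncurry.comp
        (measurable_fst.real_toNNReal.prodMk measurable_snd))
    simp_rw [h1]
    refine intervalIntegral.continuous_of_dominated_interval (bound := fun _ => ‖h‖) (fun x => ?_)
      (fun x => Eventually.of_forall fun u _ => ?_) intervalIntegrable_const
      (Eventually.of_forall fun u _ => hP.feller h _)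
    · have := hP.isProbability x
      refine (StronglyMeasurable.integral_prod_right (f := fun (u : ℝ) (w : CadlagPath S) =>
        h (w u.toNNReal)) (Measurable.stronglyMeasurable ?_)).aestronglyMeasurable
      exact h.continuous.measurable.comp (measurable_cadlagPath_uncurry.comp
        (measurable_fst.real_toNNReal.prodMk measurable_snd))
    · have := hP.isProbability x
      simpa using norm_integral_le_of_norm_le_const (μ := P x)
        (f := fun w => h (w u.toNNReal)) (Eventually.of_forall fun w => h.norm_coe_le_norm _)
  · refine LipschitzWith.of_dist_le_mul fun c c' => ?_
    have := hP.isProbability x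
    rw [dist_eq_norm, occupationMean, occupationMean,
      ← integral_sub (integrable_occupation h hP _ _) (integrable_occupation h hP _ _)]
    simpa using norm_integral_le_of_norm_le_const (μ := P x)
      (f := fun w => occupation h c w - occupation h c' w) (Eventually.of_forall fun w =>
      (lipschitzWith_occupation h w).dist_le_mul c c')

variable {Ω : Type v} {mΩ : MeasurableSpace Ω} {𝒢 : Filtration ℝ≥0 mΩ} {μ : Measure Ω}
  {X Y : Ω → CadlagPath S}

/-- The integral of `h(w_u)` over `[c, b]` minus its conditional expectation at time `c`. -/
def occupationError (P : Kernel S (CadlagPath S)) (h : C(S, ℝ)) (b : ℝ) (c : ℝ≥0)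
    (w : CadlagPath S) : ℝ :=
  occupation h b w - occupation h c w - occupationMean P h (b - c) (w c)

theorem measurable_occupationError (hP : IsFellerProcess P) (b : ℝ) (c : ℝ≥0) :
    Measurable (occupationError P h b c) :=
  ((measurable_occupation h b).sub (measurable_occupation h c)).sub
    (((continuous_occupationMean h hP).comp (Continuous.prodMk_right (b - c))).measurable.comp
      (CadlagPath.measurable_eval c))

theorem abs_occupationError_le (hP : IsFellerProcess P) {b : ℝ} {c : ℝ≥0} (hc : (c : ℝ) ≤ b)
    (w : CadlagPath S) : |occupationError P h b c w| ≤ 3 * (‖h‖ * b) := by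
  have hb : 0 ≤ b := c.coe_nonneg.trans hc
  have h1 := abs_occupation_le h b w
  have h2 := abs_occupation_le h c w
  have h3 := abs_occupationMean_le h hP (b - c) (w c)
  rw [abs_of_nonneg hb] at h1
  rw [abs_of_nonneg c.coe_nonneg] at h2
  rw [abs_of_nonneg (sub_nonneg.2 hc)] at h3
  have h4 : ‖h‖ * c ≤ ‖h‖ * b := by gcongr
  have h5 : ‖h‖ * (b - c) ≤ ‖h‖ * b := by gcongr; linarith [c.coe_nonneg]
  rw [occupationError]
  refine (abs_sub _ _).trans ?_
  have := abs_sub (occupation h b w) (occupation h c w)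
  linarith

/-- The occupation over `[c, b]` is that of the shifted path over `[0, b - c]`, so the Markov
property at the deterministic time `c` applies. -/
theorem IsMarkovWith.setIntegral_occupationError [IsFiniteMeasure μ] (hP : IsFellerProcess P)
    (hXm : Measurable X) (hX : IsMarkovWith 𝒢 μ (transition P) fun t ω => X ω t) {b : ℝ} {c : ℝ≥0}
    (hc : (c : ℝ) ≤ b) {B : Set Ω} (hB : MeasurableSet[𝒢 c] B) :
    ∫ ω in B, occupationError P h b c (X ω) ∂μ = 0 := by
  have : IsMarkovKernel P := ⟨hP.isProbability⟩
  have hXc : Measurable fun ω => X ω c := (CadlagPath.measurable_eval c).comp hXm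
  have hsh : Measurable fun ω => (X ω).shift c := (CadlagPath.measurable_shift c).comp hXm
  have hQ : Measurable (occupationMean P h (b - c)) :=
    ((continuous_occupationMean h hP).comp (Continuous.prodMk_right (b - c))).measurable
  have hmap := hX.map_shift hP hXm c hB
  have h1 : ∫ ω in B, occupation h (b - c) ((X ω).shift c) ∂μ =
      ∫ ω in B, occupationMean P h (b - c) (X ω c) ∂μ := by
    rw [← integral_map (f := occupation h (b - c)) hsh.aemeasurable
      (measurable_occupation h _).aestronglyMeasurable, hmap, integral_bind_kernel]
    · exact integral_map (f := occupationMean P h (b - c)) hXc.aemeasurable hQ.aestronglyMeasurable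
    · exact Integrable.of_measurable_of_abs_le (measurable_occupation h _) (abs_occupation_le h _)
  have h2 : ∀ ω, occupationError P h b c (X ω) =
      occupation h (b - c) ((X ω).shift c) - occupationMean P h (b - c) (X ω c) := fun ω => by
    rw [occupation_shift h _ _ (sub_nonneg.2 hc), occupationError]
    ring_nf
  simp_rw [h2]
  rw [integral_sub, h1, sub_self]
  · exact Integrable.of_measurable_of_abs_le ((measurable_occupation h _).comp hsh)
      fun ω => abs_occupation_le h _ _
  · exact Integrable.of_measurable_of_abs_le (hQ.comp hXc) fun ω => abs_occupationMean_le h hP _ _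

/-- Two Markov processes with the same transition kernels which agree at the stopping time `T` have
the same expected occupation integrals after `T`. -/
theorem setIntegral_occupation_meeting [IsFiniteMeasure μ] (hP : IsFellerProcess P)
    (hXm : Measurable X) (hX : IsMarkovWith 𝒢 μ (transition P) fun t ω => X ω t)
    (hYm : Measurable Y) (hY : IsMarkovWith 𝒢 μ (transition P) fun t ω => Y ω t)
    {T : Ω → WithTop ℝ≥0} (hT : IsStoppingTime 𝒢 T)
    (hXY : ∀ ω (t : ℝ≥0), T ω = t → X ω t = Y ω t) {B : Set Ω}
    (hB : ∀ u : ℝ≥0, MeasurableSet[𝒢 u] (B ∩ {ω | T ω ≤ u})) (b : ℝ≥0) :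
    IntegrableOn (fun ω => (occupation h b (X ω) - occupation h (T ω).untopA (X ω)) -
        (occupation h b (Y ω) - occupation h (T ω).untopA (Y ω))) (B ∩ {ω | T ω ≤ b}) μ ∧
      ∫ ω in B ∩ {ω | T ω ≤ b}, ((occupation h b (X ω) - occupation h (T ω).untopA (X ω)) -
        (occupation h b (Y ω) - occupation h (T ω).untopA (Y ω))) ∂μ = 0 := by
  set τ : Ω → ℝ≥0 := fun ω => (T ω).untopA with hτ
  let g : ℕ → ℕ → ℝ≥0 := fun n k => ((k : ℝ≥0) + 1) / (n + 1)
  -- On `D n k` the meeting time lies in `[k / (n + 1), (k + 1) / (n + 1))`. The event is known at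
  -- the right endpoint `g n k`, where the Markov property of both processes is applied.
  let D : ℕ → ℕ → Set Ω := fun n k =>
    B ∩ {ω | T ω ≤ g n k} ∩ ({ω | T ω < g n k} \ {ω | T ω < ((k / (n + 1) : ℝ≥0) : WithTop ℝ≥0)})
  have hD : ∀ n k, MeasurableSet[𝒢 (g n k)] (D n k) := fun n k => by
    refine (hB _).inter ((hT.measurableSet_lt _).diff (𝒢.mono ?_ _ (hT.measurableSet_lt _)))
    simp only [g]
    gcongr
    simp
  -- Only grid times up to `b` are kept, since `[g n k, b]` must be an interval; the range merely
  -- makes the set finite.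
  let N : ℕ → Finset ℕ := fun n => {k ∈ Finset.range (⌊(n + 1) * b⌋₊ + 1) | g n k ≤ b}
  let err : ℕ → ℕ → Ω → ℝ := fun n k ω =>
    occupationError P h b (g n k) (X ω) - occupationError P h b (g n k) (Y ω)
  let Z : ℕ → Ω → ℝ := fun n ω => ∑ k ∈ N n, (D n k).indicator (err n k) ω
  have herr : ∀ n k, Measurable (err n k) := fun n k =>
    ((measurable_occupationError h hP _ _).comp hXm).sub
      ((measurable_occupationError h hP _ _).comp hYm)
  have hmem : ∀ n k ω (t : ℝ≥0), T ω = t → (ω ∈ D n k ↔ ω ∈ B ∧ ⌊((n : ℝ≥0) + 1) * t⌋₊ = k) := by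
    intro n k ω t ht
    have hlt : t < g n k ↔ ((n : ℝ≥0) + 1) * t < k + 1 := by
      rw [lt_div_iff₀ (by positivity), mul_comm]
    have hle : (k : ℝ≥0) / (n + 1) ≤ t ↔ (k : ℝ≥0) ≤ (n + 1) * t := by
      rw [div_le_iff₀ (by positivity), mul_comm]
    simp only [D, mem_inter_iff, Set.mem_sdiff, mem_ofPred_eq, ht, WithTop.coe_le_coe, WithTop.coe_lt_coe,
      not_lt]
    rw [Nat.floor_eq_iff (by positivity), ← hle, ← hlt]
    exact ⟨fun h => ⟨h.1.1, h.2.2, h.2.1⟩, fun h => ⟨⟨h.1, h.2.2.le⟩, h.2.2, h.2.1⟩⟩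
  have hZ : ∀ n ω (t : ℝ≥0), T ω = t → ω ∈ B → Z n ω = if gridAbove n t ≤ b then
      occupationError P h b (gridAbove n t) (X ω) - occupationError P h b (gridAbove n t) (Y ω)
      else 0 := by
    intro n ω t ht hω
    have hg : gridAbove n t = g n ⌊((n : ℝ≥0) + 1) * t⌋₊ := rfl
    have hi : ∀ k, (D n k).indicator (err n k) ω =
        if ⌊((n : ℝ≥0) + 1) * t⌋₊ = k then err n k ω else 0 := fun k => by
      by_cases hk : ⌊((n : ℝ≥0) + 1) * t⌋₊ = k
      · rw [indicator_of_mem ((hmem n k ω t ht).2 ⟨hω, hk⟩), if_pos hk]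
      · rw [indicator_of_notMem fun h' => hk ((hmem n k ω t ht).1 h').2, if_neg hk]
    simp only [Z, hi, Finset.sum_ite_eq, err, hg]
    refine if_congr ?_ rfl rfl
    simp only [N, Finset.mem_filter, Finset.mem_range, and_iff_right_iff_imp]
    intro h1
    rw [div_le_iff₀' (by positivity)] at h1
    exact Nat.lt_succ_of_le (Nat.le_floor (le_self_add.trans h1))
  have hZ0 : ∀ n ω, ω ∉ B ∨ T ω = ⊤ → Z n ω = 0 := by
    intro n ω hω
    refine Finset.sum_eq_zero fun k _ => indicator_of_notMem (fun hk => ?_) _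
    rcases hω with hω | hω
    · exact hω hk.1.1
    · have h1 : T ω < g n k := hk.2.1
      rw [hω] at h1
      exact not_top_lt h1
  have hZm : ∀ n, Measurable (Z n) := fun n =>
    Finset.measurable_fun_sum _ fun k _ => (herr n k).indicator (𝒢.le _ _ (hD n k))
  have hZb : ∀ n ω, ‖Z n ω‖ ≤ 6 * (‖h‖ * b) := by
    intro n ω
    by_cases hω : ω ∈ B ∧ T ω ≠ ⊤
    · obtain ⟨t, ht⟩ := WithTop.ne_top_iff_exists.1 hω.2
      rw [hZ n ω t ht.symm hω.1]
      split_ifs with h1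
      · have h1' : (gridAbove n t : ℝ) ≤ b := by exact_mod_cast h1
        have h2 := abs_occupationError_le h hP h1' (X ω)
        have h3 := abs_occupationError_le h hP h1' (Y ω)
        exact (abs_sub _ _).trans (by linarith)
      · rw [norm_zero]; positivity
    · rw [hZ0 n ω (by tauto), norm_zero]
      positivity
  have hZint : ∀ n, ∫ ω, Z n ω ∂μ = 0 := by
    intro n
    simp only [Z]
    have hei : ∀ k ∈ N n, ∀ W : Ω → CadlagPath S, Measurable W →
        Integrable (fun ω => occupationError P h b (g n k) (W ω)) (μ.restrict (D n k)) :=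
      fun k hk W hW => Integrable.of_measurable_of_abs_le
        ((measurable_occupationError h hP _ _).comp hW) fun ω => abs_occupationError_le h hP
          (by exact_mod_cast (Finset.mem_filter.1 hk).2) (W ω)
    rw [integral_finsetSum]
    · refine Finset.sum_eq_zero fun k hk => ?_
      have hk' : (g n k : ℝ) ≤ b := by exact_mod_cast (Finset.mem_filter.1 hk).2
      rw [integral_indicator (𝒢.le _ _ (hD n k)), integral_sub (hei k hk X hXm) (hei k hk Y hYm),
        hX.setIntegral_occupationError h hP hXm hk' (hD n k),
        hY.setIntegral_occupationError h hP hYm hk' (hD n k), sub_zero]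
    · intro k hk
      exact (integrable_indicator_iff (𝒢.le _ _ (hD n k))).2
        ((hei k hk X hXm).sub (hei k hk Y hYm))
  let lim : Ω → ℝ := fun ω => (occupation h b (X ω) - occupation h (τ ω) (X ω)) -
    (occupation h b (Y ω) - occupation h (τ ω) (Y ω))
  have hBm : MeasurableSet (B ∩ {ω | T ω ≤ b}) := 𝒢.le _ _ (hB b)
  have hlim : ∀ᵐ ω ∂μ, Tendsto (fun n => Z n ω) atTop
      (𝓝 ((B ∩ {ω | T ω ≤ b}).indicator lim ω)) := by
    refine Eventually.of_forall fun ω => ?_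
    by_cases hω : ω ∈ B ∧ T ω ≠ ⊤
    swap
    · have h1 : ω ∉ B ∩ {ω | T ω ≤ b} := fun h2 => hω ⟨h2.1, ne_top_of_le_ne_top
        WithTop.coe_ne_top h2.2⟩
      rw [indicator_of_notMem h1]
      simp_rw [fun n => hZ0 n ω (by tauto)]
      exact tendsto_const_nhds
    obtain ⟨t, ht⟩ := WithTop.ne_top_iff_exists.1 hω.2
    have hτt : τ ω = t := by
      simp only [hτ, ← ht]
      rfl
    simp_rw [fun n => hZ n ω t ht.symm hω.1]
    rcases le_or_gt b t with hbt | hbt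
    · have h1 : (B ∩ {ω | T ω ≤ b}).indicator lim ω = 0 := by
        by_cases hmem : ω ∈ B ∩ {ω | T ω ≤ b}
        · have h3 : T ω ≤ b := hmem.2
          rw [← ht, WithTop.coe_le_coe] at h3
          rw [indicator_of_mem hmem]
          simp [lim, hτt, le_antisymm hbt h3]
        · exact indicator_of_notMem hmem _
      rw [h1]
      exact tendsto_const_nhds.congr fun n => (if_neg (not_le.2 (hbt.trans_lt (lt_gridAbove n t)))).symm
    · have h1 : ω ∈ B ∩ {ω | T ω ≤ b} := ⟨hω.1, by
        change T ω ≤ b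
        rw [← ht]
        exact WithTop.coe_le_coe.2 hbt.le⟩
      rw [indicator_of_mem h1]
      have hgrid : Tendsto (fun n => gridAbove n t) atTop (𝓝 t) :=
        (tendsto_gridAbove t).mono_right nhdsWithin_le_nhds
      have hW : ∀ w : CadlagPath S, Tendsto (fun n => occupationError P h b (gridAbove n t) w) atTop
          (𝓝 (occupationError P h b t w)) := fun w => by
        refine Tendsto.sub (tendsto_const_nhds.sub ?_) ?_
        · exact (lipschitzWith_occupation h w).continuous.continuousAt.tendsto.comp
            ((NNReal.continuous_coe.tendsto t).comp hgrid)
        · exact ((continuous_occupationMean h hP).tendsto ((b : ℝ) - t, w t)).comp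
            ((tendsto_const_nhds.sub ((NNReal.continuous_coe.tendsto t).comp hgrid)).prodMk_nhds
              (w.tendsto_gridAbove t))
      have h2 := (hW (X ω)).sub (hW (Y ω))
      -- The two means are equal because the states agree at the meeting time; only the occupation
      -- integrals after it remain.
      have h3 : occupationError P h b t (X ω) - occupationError P h b t (Y ω) = lim ω := by
        simp only [lim]
        rw [occupationError, occupationError, hXY ω t ht.symm, hτt]
        ring
      rw [← h3]
      refine h2.congr' ?_
      filter_upwards [hgrid.eventually_lt_const hbt] with n hn
      rw [if_pos hn.le]
  have hZm' := fun n => (hZm n).aestronglyMeasurable (μ := μ)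
  have hb := fun n => Eventually.of_forall (f := ae μ) (hZb n)
  refine ⟨(integrable_indicator_iff hBm).1 ⟨aestronglyMeasurable_of_tendsto_ae atTop hZm' hlim,
    hasFiniteIntegral_of_dominated_convergence (integrable_const _).2 hb hlim⟩, ?_⟩
  rw [← integral_indicator hBm]
  refine tendsto_nhds_unique (tendsto_integral_of_dominated_convergence (F := Z) _ hZm'
    (integrable_const _) hb hlim) ?_
  simp_rw [hZint]
  exact tendsto_const_nhds

/-- Right-continuity of the path makes `h (w r)` the right derivative of the occupation integral;
this recovers single times from the integrated identities. -/
theorem tendsto_occupation_div (w : CadlagPath S) (r : ℝ≥0) :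
    Tendsto (fun n : ℕ => ((n : ℝ) + 1) *
      (occupation h ((r + 1 / (n + 1) : ℝ≥0) : ℝ) w - occupation h r w)) atTop (𝓝 (h (w r))) := by
  have h1 : HasDerivWithinAt (fun c : ℝ => occupation h c w) (h (w (r : ℝ).toNNReal)) (Ici (r : ℝ)) r := by
    refine intervalIntegral.integral_hasDerivWithinAt_right (intervalIntegrable_comp_path h w 0 r)
      (t := Ioi (r : ℝ)) (measurable_comp_path h w).stronglyMeasurable.stronglyMeasurableAtFilter ?_
    refine ContinuousWithinAt.mono (t := Ici (r : ℝ)) ?_ Ioi_subset_Ici_self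
    refine h.continuous.continuousAt.comp_continuousWithinAt (f := fun u : ℝ => w u.toNNReal) ?_
    exact (w.continuousWithinAt (r : ℝ).toNNReal).comp (f := fun u : ℝ => u.toNNReal)
      (Continuous.continuousWithinAt (by fun_prop)) fun u hu => Real.toNNReal_mono hu
  rw [Real.toNNReal_coe] at h1
  have h2 := (hasDerivWithinAt_iff_tendsto_slope' (by simp)).1 (h1.mono Ioi_subset_Ici_self)
  have h3 : Tendsto (fun n : ℕ => (r : ℝ) + 1 / ((n : ℝ) + 1)) atTop (𝓝[>] (r : ℝ)) := by
    refine tendsto_nhdsWithin_iff.2 ⟨?_, Eventually.of_forall fun n => ?_⟩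
    · simpa using (tendsto_const_nhds (x := (r : ℝ))).add
        (tendsto_one_div_add_atTop_nhds_zero_nat (𝕜 := ℝ))
    · simp only [mem_Ioi, lt_add_iff_pos_right]
      positivity
  refine (h2.comp h3).congr fun n => ?_
  simp [slope_def_field]
  ring

/-- Two Markov processes with the same transition kernels which agree at the stopping time `T` have
the same conditional laws after `T`. -/
theorem measure_inter_meeting [IsFiniteMeasure μ] (hP : IsFellerProcess P)
    (hXm : Measurable X) (hX : IsMarkovWith 𝒢 μ (transition P) fun t ω => X ω t)
    (hYm : Measurable Y) (hY : IsMarkovWith 𝒢 μ (transition P) fun t ω => Y ω t)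
    {T : Ω → WithTop ℝ≥0} (hT : IsStoppingTime 𝒢 T)
    (hXY : ∀ ω (t : ℝ≥0), T ω = t → X ω t = Y ω t) {B : Set Ω}
    (hB : ∀ u : ℝ≥0, MeasurableSet[𝒢 u] (B ∩ {ω | T ω ≤ u})) (r : ℝ≥0) :
    (μ.restrict (B ∩ {ω | T ω ≤ r})).map (fun ω => X ω r) =
      (μ.restrict (B ∩ {ω | T ω ≤ r})).map (fun ω => Y ω r) := by
  have hXr : Measurable fun ω => X ω r := (CadlagPath.measurable_eval r).comp hXm
  have hYr : Measurable fun ω => Y ω r := (CadlagPath.measurable_eval r).comp hYm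
  set E := B ∩ {ω | T ω ≤ r} with hE
  have hEm : MeasurableSet E := 𝒢.le _ _ (hB r)
  have hE' : ∀ u : ℝ≥0, MeasurableSet[𝒢 u] (E ∩ {ω | T ω ≤ u}) := fun u => by
    have : E ∩ {ω | T ω ≤ u} = (B ∩ {ω | T ω ≤ u}) ∩ {ω | T ω ≤ min r u} := by
      ext ω
      simp only [hE, mem_inter_iff, mem_ofPred_eq, WithTop.coe_min, le_min_iff]
      tauto
    rw [this]
    exact (hB u).inter (𝒢.mono (min_le_right r u) _ (hT (min r u)))
  refine ext_of_forall_integral_eq_of_IsFiniteMeasure fun h' => ?_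
  let h : C(S, ℝ) := h'.toContinuousMap
  rw [integral_map hXr.aemeasurable h'.continuous.measurable.aestronglyMeasurable,
    integral_map hYr.aemeasurable h'.continuous.measurable.aestronglyMeasurable]
  have hocc : ∀ (c : ℝ) (W : Ω → CadlagPath S), Measurable W →
      Integrable (fun ω => occupation h c (W ω)) (μ.restrict E) := fun c W hW =>
    Integrable.of_measurable_of_abs_le ((measurable_occupation h c).comp hW)
      fun ω => abs_occupation_le h c _
  have hEr : ∀ b : ℝ≥0, r ≤ b → E ∩ {ω | T ω ≤ b} = E := fun b hb =>
    inter_eq_left.2 fun ω hω => le_trans (b := (r : WithTop ℝ≥0)) hω.2 (WithTop.coe_le_coe.2 hb)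
  -- Subtracting the identities for `b` and `r` on the common event `E` eliminates the integrals up
  -- to the random time `T`.
  have key : ∀ b : ℝ≥0, r ≤ b → ∫ ω in E, ((occupation h b (X ω) - occupation h r (X ω)) -
      (occupation h b (Y ω) - occupation h r (Y ω))) ∂μ = 0 := by
    intro b hb
    obtain ⟨hi1, h1⟩ := setIntegral_occupation_meeting h hP hXm hX hYm hY hT hXY hE' b
    obtain ⟨hi2, h2⟩ := setIntegral_occupation_meeting h hP hXm hX hYm hY hT hXY hE' r
    rw [hEr b hb] at hi1 h1
    rw [hEr r le_rfl] at hi2 h2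
    have h3 := integral_sub hi1 hi2
    rw [h1, h2, sub_zero] at h3
    rw [← h3]
    congr 1 with ω
    ring
  let G : ℕ → CadlagPath S → ℝ := fun n w => ((n : ℝ) + 1) *
    (occupation h ((r + 1 / (n + 1) : ℝ≥0) : ℝ) w - occupation h r w)
  have hGm : ∀ n, Measurable (G n) := fun n =>
    ((measurable_occupation h _).sub (measurable_occupation h _)).const_mul _
  have hGb : ∀ n w, |G n w| ≤ ‖h‖ := fun n w => by
    have h1 := (lipschitzWith_occupation h w).dist_le_mul ((r + 1 / (n + 1) : ℝ≥0) : ℝ) r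
    have h2 : dist ((r + 1 / (n + 1) : ℝ≥0) : ℝ) r = 1 / ((n : ℝ) + 1) := by
      rw [Real.dist_eq]
      push_cast
      rw [add_sub_cancel_left, abs_of_nonneg (by positivity)]
    rw [h2, Real.dist_eq, coe_nnnorm] at h1
    have h3 : |(n : ℝ) + 1| = (n : ℝ) + 1 := abs_of_nonneg (by positivity)
    simp only [G]
    rw [abs_mul, h3]
    calc _ ≤ ((n : ℝ) + 1) * (‖h‖ * (1 / ((n : ℝ) + 1))) := by gcongr
      _ = ‖h‖ := by field_simp
  have hG0 : ∀ n, ∫ ω in E, (G n (X ω) - G n (Y ω)) ∂μ = 0 := fun n => by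
    have h1 : ∀ ω, G n (X ω) - G n (Y ω) = ((n : ℝ) + 1) *
        ((occupation h ((r + 1 / (n + 1) : ℝ≥0) : ℝ) (X ω) - occupation h r (X ω)) -
          (occupation h ((r + 1 / (n + 1) : ℝ≥0) : ℝ) (Y ω) - occupation h r (Y ω))) := fun ω => by
      simp only [G]
      ring
    simp_rw [h1]
    rw [integral_const_mul, key _ le_self_add, mul_zero]
  have hlim := tendsto_integral_of_dominated_convergence (μ := μ.restrict E)
    (F := fun n ω => G n (X ω) - G n (Y ω)) (f := fun ω => h (X ω r) - h (Y ω r))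
    (fun _ => ‖h‖ + ‖h‖) (fun n => (((hGm n).comp hXm).sub ((hGm n).comp hYm)).aestronglyMeasurable)
    (integrable_const _)
    (fun n => Eventually.of_forall fun ω => (norm_sub_le _ _).trans
      (add_le_add (hGb n _) (hGb n _)))
    (Eventually.of_forall fun ω => (tendsto_occupation_div h _ r).sub (tendsto_occupation_div h _ r))
  simp_rw [hG0] at hlim
  have h4 := tendsto_nhds_unique hlim tendsto_const_nhds
  have hi : ∀ W : Ω → S, Measurable W → Integrable (fun ω => h (W ω)) (μ.restrict E) := fun W hW =>
    Integrable.of_measurable_of_abs_le (h.continuous.measurable.comp hW)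
      fun ω => h.norm_coe_le_norm _
  rw [integral_sub (hi _ hXr) (hi _ hYr)] at h4
  exact sub_eq_zero.1 h4

end StrongMarkov

/-! ### Merging two coupled processes at their meeting time -/

section Merging

variable {S : Type u} [TopologicalSpace S]

variable [MeasurableSpace S] {Ω : Type v} {mΩ : MeasurableSpace Ω} {𝒢 : Filtration ℝ≥0 mΩ} {μ : Measure Ω}
  {X Y : Ω → CadlagPath S} {T : Ω → WithTop ℝ≥0}

theorem measurable_glue_apply (hT : IsStoppingTime 𝒢 T) (hX : ∀ t, Measurable[𝒢 t] fun ω => X ω t)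
    (hY : ∀ t, Measurable[𝒢 t] fun ω => Y ω t) (t : ℝ≥0) :
    Measurable[𝒢 t] fun ω => CadlagPath.glue (T ω) (Y ω) (X ω) t :=
  Measurable.ite (hT t) (hX t) (hY t)

variable [PolishSpace S]

-- The infimum of the meeting times is in their closure and none precedes it, so right-continuity
-- carries the equality to the infimum itself.
omit [MeasurableSpace S] in
theorem eq_of_hittingAfter_diagonal {Ω : Type v} {X Y : Ω → CadlagPath S} {ω : Ω} {t : ℝ≥0}
    (h : hittingAfter (fun t ω => (X ω t, Y ω t)) (diagonal S) (0 : ℝ≥0) ω = t) :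
    X ω t = Y ω t := by
  set A : Set ℝ≥0 := {i | 0 ≤ i ∧ (X ω i, Y ω i) ∈ diagonal S} with hA
  have hne : A.Nonempty := by
    by_contra hne
    have h1 := (hittingAfter_eq_top_iff (u := fun t ω => (X ω t, Y ω t)) (s := diagonal S)
      (n := (0 : ℝ≥0)) (ω := ω)).2 fun (j : ℝ≥0) hj hm => hne ⟨j, hj, hm⟩
    rw [h1] at h
    exact WithTop.top_ne_coe h
  have hInf : sInf A = t := by
    classical
    obtain ⟨j, hj⟩ := hne
    rw [hittingAfter, if_pos ⟨j, hj.1, hj.2⟩] at h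
    exact WithTop.coe_injective h
  have hcl : t ∈ closure A := hInf ▸ csInf_mem_closure hne (OrderBot.bddBelow A)
  have hsub : A ⊆ Ici t := fun i hi => hInf ▸ csInf_le (OrderBot.bddBelow A) hi
  have := mem_closure_iff_nhdsWithin_neBot.1 hcl
  have h1 : Tendsto (X ω) (𝓝[A] t) (𝓝 (X ω t)) := ((X ω).continuousWithinAt t).mono hsub
  have h2 : Tendsto (Y ω) (𝓝[A] t) (𝓝 (Y ω t)) := ((Y ω).continuousWithinAt t).mono hsub
  refine tendsto_nhds_unique (h1.congr' ?_) h2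
  filter_upwards [self_mem_nhdsWithin] with i hi using hi.2

variable [CompactSpace S] [BorelSpace S] {P : Kernel S (CadlagPath S)}

/-- Following `Y` before the meeting time and `X` afterwards gives a Markov process. -/
theorem IsMarkovWith.glue [IsFiniteMeasure μ] (hP : IsFellerProcess P)
    (hXm : Measurable X) (hX : IsMarkovWith 𝒢 μ (transition P) fun t ω => X ω t)
    (hYm : Measurable Y) (hY : IsMarkovWith 𝒢 μ (transition P) fun t ω => Y ω t)
    (hT : IsStoppingTime 𝒢 T) (hXY : ∀ ω (t : ℝ≥0), T ω = t → X ω t = Y ω t) :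
    IsMarkovWith 𝒢 μ (transition P) fun t ω => CadlagPath.glue (T ω) (Y ω) (X ω) t := by
  refine ⟨measurable_glue_apply hT hX.1 hY.1, fun s t A B hA hB => ?_⟩
  set Z : Ω → CadlagPath S := fun ω => CadlagPath.glue (T ω) (Y ω) (X ω) with hZ
  have hZm : ∀ t, Measurable fun ω => Z ω t := fun t =>
    (measurable_glue_apply hT hX.1 hY.1 t).mono (𝒢.le t) le_rfl
  have hXt : ∀ t, Measurable fun ω => X ω t := fun t => (hX.1 t).mono (𝒢.le t) le_rfl
  have hYt : ∀ t, Measurable fun ω => Y ω t := fun t => (hY.1 t).mono (𝒢.le t) le_rfl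
  set E : Set Ω := {ω | T ω ≤ s} with hE
  have hEs : MeasurableSet[𝒢 s] E := hT s
  have hEm : MeasurableSet E := 𝒢.le _ _ hEs
  set E' : Set Ω := {ω | T ω ≤ (s + t : ℝ≥0)} with hE'
  have hE'm : MeasurableSet E' := 𝒢.le _ _ (hT (s + t))
  have hEE' : E ⊆ E' := fun ω hω =>
    le_trans (b := (s : WithTop ℝ≥0)) hω (WithTop.coe_le_coe.2 le_self_add)
  -- If the processes have met by time `s`, the glued path is `X` at both times and the Markov
  -- property of `X` applies.
  have h1 : μ ((B ∩ E) ∩ (fun ω => Z ω (s + t)) ⁻¹' A) =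
      ∫⁻ ω in B ∩ E, transition P t (Z ω s) A ∂μ := by
    have e1 : (B ∩ E) ∩ (fun ω => Z ω (s + t)) ⁻¹' A = (B ∩ E) ∩ (fun ω => X ω (s + t)) ⁻¹' A := by
      ext ω
      refine and_congr_right fun hω => ?_
      simp only [mem_preimage, hZ, CadlagPath.glue_apply_of_le (hEE' hω.2)]
    rw [e1, hX.2 s t A _ hA (hB.inter hEs)]
    refine setLIntegral_congr_fun ((𝒢.le _ _ hB).inter hEm) fun ω hω => ?_
    simp only [hZ, CadlagPath.glue_apply_of_le hω.2]
  -- The part of `B` on which `T > s` belongs to the past of `T`: it cannot meet `{T ≤ u}` unless `u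
  -- > s`, and by then `B` is known.
  have hBE : ∀ u : ℝ≥0, MeasurableSet[𝒢 u] ((B \ E) ∩ {ω | T ω ≤ u}) := fun u => by
    rcases le_total u s with hus | hus
    · have : (B \ E) ∩ {ω | T ω ≤ u} = ∅ := by
        refine eq_empty_of_forall_notMem fun ω hω => hω.1.2 ?_
        exact le_trans (b := (u : WithTop ℝ≥0)) hω.2 (WithTop.coe_le_coe.2 hus)
      rw [this]
      exact @MeasurableSet.empty _ (𝒢 u)
    · exact (𝒢.mono hus _ (hB.diff hEs)).inter (hT u)
  have hmeet : μ (((B \ E) ∩ E') ∩ (fun ω => X ω (s + t)) ⁻¹' A) =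
      μ (((B \ E) ∩ E') ∩ (fun ω => Y ω (s + t)) ⁻¹' A) := by
    have := congrArg (fun ν : Measure S => ν A)
      (measure_inter_meeting hP hXm hX hYm hY hT hXY hBE (s + t))
    simp only [Measure.map_apply (hXt _) hA, Measure.map_apply (hYt _) hA,
      Measure.restrict_apply (hXt _ hA), Measure.restrict_apply (hYt _ hA)] at this
    rw [inter_comm, this, inter_comm]
  -- Without a meeting by time `s`, the glued path is `Y` at time `s`. It may be `X` at time `s +
  -- t`, but the strong Markov identity `hmeet` allows `X` to be exchanged for `Y` there, and the
  -- Markov property of `Y` applies.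
  have h2 : μ ((B \ E) ∩ (fun ω => Z ω (s + t)) ⁻¹' A) =
      ∫⁻ ω in B \ E, transition P t (Z ω s) A ∂μ := by
    have e1 : ((B \ E) ∩ (fun ω => Z ω (s + t)) ⁻¹' A) ∩ E' =
        ((B \ E) ∩ E') ∩ (fun ω => X ω (s + t)) ⁻¹' A := by
      rw [inter_right_comm]
      ext ω
      refine and_congr_right fun hω => ?_
      simp only [mem_preimage, hZ, CadlagPath.glue_apply_of_le hω.2]
    have e2 : ((B \ E) ∩ (fun ω => Z ω (s + t)) ⁻¹' A) \ E' =
        ((B \ E) ∩ (fun ω => Y ω (s + t)) ⁻¹' A) \ E' := by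
      ext ω
      simp only [Set.mem_sdiff, mem_inter_iff, and_congr_left_iff]
      intro hω
      refine and_congr_right fun _ => ?_
      simp only [mem_preimage, hZ, CadlagPath.glue_apply_of_lt (not_le.1 hω)]
    have e3 : ((B \ E) ∩ E') ∩ (fun ω => Y ω (s + t)) ⁻¹' A =
        ((B \ E) ∩ (fun ω => Y ω (s + t)) ⁻¹' A) ∩ E' := inter_right_comm _ _ _
    rw [← measure_inter_add_sdiff _ hE'm, e1, e2, hmeet, e3, measure_inter_add_sdiff _ hE'm,
      hY.2 s t A _ hA (hB.diff hEs)]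
    refine setLIntegral_congr_fun ((𝒢.le _ _ hB).diff hEm) fun ω hω => ?_
    simp only [hZ, CadlagPath.glue_apply_of_lt (not_le.1 hω.2)]
  have e0 : B ∩ (fun ω => Z ω (s + t)) ⁻¹' A ∩ E = (B ∩ E) ∩ (fun ω => Z ω (s + t)) ⁻¹' A :=
    inter_right_comm _ _ _
  have e0' : (B ∩ (fun ω => Z ω (s + t)) ⁻¹' A) \ E = (B \ E) ∩ (fun ω => Z ω (s + t)) ⁻¹' A := by
    ext ω
    simp only [Set.mem_sdiff, mem_inter_iff]
    tauto
  rw [← measure_inter_add_sdiff _ hEm, e0, e0', h1, h2, lintegral_inter_add_sdiff _ _ hEm]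

/-- The coupling of `HasExponentialCoupling` can be chosen so that the two processes stay together
after they have met. -/
theorem HasExponentialCoupling.exists_merging (hP : IsFellerProcess P) {π : Measure S} {C δ : ℝ}
    (hc : HasExponentialCoupling.{u, v} P π C δ) (x : S) :
    ∃ (Ω : Type v) (_ : MeasurableSpace Ω) (μ : Measure Ω) (X Z : Ω → CadlagPath S),
      IsProbabilityMeasure μ ∧ Measurable X ∧ Measurable Z ∧ μ.map X = P x ∧
      μ.map Z = lawFrom P π ∧ ∀ t : ℝ≥0, ∃ E : Set Ω, MeasurableSet E ∧
        μ E ≤ ENNReal.ofReal (C * Real.exp (-δ * t)) ∧ ∀ ω ∉ E, ∀ s, t ≤ s → X ω s = Z ω s := by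
  obtain ⟨Ω, mΩ, μ, 𝒢, X, Y, hμ, hXm, hYm, hX, hY, hXM, hYM, hT, htail⟩ := hc x
  have hXY : ∀ ω (t : ℝ≥0), hittingAfter (fun t ω => (X ω t, Y ω t)) (diagonal S) (0 : ℝ≥0) ω = t →
      X ω t = Y ω t := fun ω t => eq_of_hittingAfter_diagonal
  set T := hittingAfter (fun t ω => (X ω t, Y ω t)) (diagonal S) (0 : ℝ≥0) with hTdef
  set Z : Ω → CadlagPath S := fun ω => CadlagPath.glue (T ω) (Y ω) (X ω) with hZ
  have hZm : Measurable Z := measurable_cadlagPath_iff.2 fun t =>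
    (measurable_glue_apply hT hXM.1 hYM.1 t).mono (𝒢.le t) le_rfl
  refine ⟨Ω, mΩ, μ, X, Z, hμ, hXm, hZm, hX, ?_, fun t => ⟨{ω | t ≤ T ω}, ?_, htail t, ?_⟩⟩
  · have h1 := (IsMarkovWith.glue hP hXm hXM hYm hYM hT hXY).map_eq_lawFrom (X := Z) hP hZm
    -- The glued process has initial law `π`, as switching at time `0` requires the two initial
    -- states to agree. Being Markov, its law is then `ℙ_π`.
    have h2 : (fun ω => Z ω 0) = fun ω => Y ω 0 := by
      funext ω
      by_cases h0 : T ω ≤ (0 : ℝ≥0)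
      · have h3 : T ω = (0 : ℝ≥0) := le_antisymm h0 (by simp)
        exact (CadlagPath.glue_apply_of_le h0 _ _).trans (hXY ω 0 h3)
      · exact CadlagPath.glue_apply_of_lt (not_le.1 h0) _ _
    have : IsMarkovKernel P := ⟨hP.isProbability⟩
    have h3 : μ.map (fun ω => Y ω 0) = π := by
      have h4 : μ.map (fun ω => Y ω 0) = (μ.map Y).map fun w => w 0 :=
        (Measure.map_map (CadlagPath.measurable_eval 0) hYm).symm
      rw [h4, hY, lawFrom_map_eval]
      ext A hA
      rw [Measure.bind_apply hA (transition P 0).aemeasurable, ← lintegral_indicator_one hA]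
      refine lintegral_congr fun y => ?_
      rw [transition_apply', Measure.map_congr (g := fun _ => y) (hP.start y), Measure.map_const]
      simp [hA]
    rw [h2, h3] at h1
    exact h1
  · have : {ω | t ≤ T ω} = {ω | T ω < t}ᶜ := by
      ext ω
      exact (not_lt (a := T ω)).symm
    rw [this]
    exact (𝒢.le _ _ (hT.measurableSet_lt t)).compl
  · intro ω hω s hs
    have h1 : T ω ≤ s := (not_le.1 hω).le.trans (WithTop.coe_le_coe.2 hs)
    exact (CadlagPath.glue_apply_of_le h1 _ _).symm

end Merging

/-! ### Wasserstein distances -/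

section Wasserstein

theorem wasserstein_map_le {Ω : Type*} {mΩ : MeasurableSpace Ω} {X : Type u} [MeasurableSpace X]
    (c : X → X → ℝ) (μ : Measure Ω) {U V : Ω → X} (hU : Measurable U) (hV : Measurable V) :
    wasserstein c (μ.map U) (μ.map V) ≤ ∫⁻ ω, ENNReal.ofReal (c (U ω) (V ω)) ∂μ := by
  refine (iInf₂_le (μ.map fun ω => (U ω, V ω)) ⟨?_, ?_⟩).trans (lintegral_map_le _ _)
  · exact Measure.map_map measurable_fst (hU.prodMk hV)
  · exact Measure.map_map measurable_snd (hU.prodMk hV)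

/-- Gluing of two couplings along their common marginal. -/
theorem exists_gluing {X : Type*} [MeasurableSpace X] [StandardBorelSpace X] [Nonempty X]
    (Γ₁ Γ₂ : Measure (X × X)) [IsFiniteMeasure Γ₁] [IsFiniteMeasure Γ₂]
    (h : Γ₁.map Prod.snd = Γ₂.map Prod.fst) :
    ∃ Γ : Measure ((X × X) × X), Γ.map Prod.fst = Γ₁ ∧ Γ.map (fun p => (p.1.2, p.2)) = Γ₂ := by
  -- Given the pair drawn from `Γ₁`, the third point is drawn from the conditional law under `Γ₂`
  -- given the middle point.
  refine ⟨Γ₁ ⊗ₘ Γ₂.condKernel.comap Prod.snd measurable_snd, Measure.fst_compProd _ _, ?_⟩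
  have hm : Measurable fun p : (X × X) × X => (p.1.2, p.2) :=
    measurable_fst.snd.prodMk measurable_snd
  refine Measure.ext_of_lintegral _ fun φ hφ => ?_
  rw [lintegral_map hφ hm, Measure.lintegral_compProd
    (f := fun p : (X × X) × X => φ (p.1.2, p.2)) (hφ.comp hm)]
  change ∫⁻ a : X × X, (fun y => ∫⁻ b, φ (y, b) ∂(Γ₂.condKernel y)) a.2 ∂Γ₁ = _
  rw [← lintegral_map (hφ.lintegral_kernel_prod_right' (κ := Γ₂.condKernel)) measurable_snd, h]
  change ∫⁻ y, ∫⁻ b, φ (y, b) ∂(Γ₂.condKernel y) ∂Γ₂.fst = _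
  rw [← Measure.lintegral_compProd hφ, Measure.disintegrate]

theorem isFiniteMeasure_of_map_eq {α β : Type*} [MeasurableSpace α] [MeasurableSpace β]
    {μ : Measure α} {ν : Measure β} [IsFiniteMeasure ν] {g : α → β} (hg : Measurable g)
    (h : μ.map g = ν) : IsFiniteMeasure μ :=
  ⟨by rw [← preimage_univ (f := g), ← Measure.map_apply hg .univ, h]; exact measure_lt_top _ _⟩

/-- No optimal couplings are needed: every pair of couplings is glued along `ν`, and the infima are
taken afterwards. -/
theorem wasserstein_triangle {X : Type u} [MeasurableSpace X] [StandardBorelSpace X] [Nonempty X]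
    {c : X → X → ℝ} (hc : Measurable fun p : X × X => c p.1 p.2) (hc0 : ∀ x y, 0 ≤ c x y)
    (htri : ∀ x y z, c x z ≤ c x y + c y z) (μ ν ρ : Measure X) [IsFiniteMeasure μ]
    [IsFiniteMeasure ν] :
    wasserstein c μ ρ ≤ wasserstein c μ ν + wasserstein c ν ρ := by
  simp_rw [wasserstein, ENNReal.iInf_add, ENNReal.add_iInf]
  refine le_iInf₂ fun Γ₁ h₁ => le_iInf₂ fun Γ₂ h₂ => ?_
  have := isFiniteMeasure_of_map_eq measurable_fst h₁.1
  have := isFiniteMeasure_of_map_eq measurable_fst h₂.1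
  obtain ⟨Γ, hΓ₁, hΓ₂⟩ := exists_gluing Γ₁ Γ₂ (h₁.2.trans h₂.1.symm)
  have hm : Measurable fun p : (X × X) × X => (p.1.2, p.2) :=
    measurable_fst.snd.prodMk measurable_snd
  have hm' : Measurable fun p : (X × X) × X => (p.1.1, p.2) :=
    measurable_fst.fst.prodMk measurable_snd
  have hc' : Measurable fun p : X × X => ENNReal.ofReal (c p.1 p.2) := hc.ennreal_ofReal
  have hcoup : (Γ.map fun p => (p.1.1, p.2)).map Prod.fst = μ ∧
      (Γ.map fun p => (p.1.1, p.2)).map Prod.snd = ρ := by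
    constructor
    · rw [Measure.map_map measurable_fst hm', ← h₁.1, ← hΓ₁, Measure.map_map measurable_fst
        measurable_fst]
      rfl
    · rw [Measure.map_map measurable_snd hm', ← h₂.2, ← hΓ₂, Measure.map_map measurable_snd hm]
      rfl
  refine (iInf₂_le (f := fun (Γ : Measure (X × X)) (_ : Γ.map Prod.fst = μ ∧ Γ.map Prod.snd = ρ) =>
    ∫⁻ z, ENNReal.ofReal (c z.1 z.2) ∂Γ) _ hcoup).trans ?_
  rw [lintegral_map hc' hm']
  calc ∫⁻ p, ENNReal.ofReal (c p.1.1 p.2) ∂Γ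
        ≤ ∫⁻ p, (ENNReal.ofReal (c p.1.1 p.1.2) + ENNReal.ofReal (c p.1.2 p.2)) ∂Γ := by
          refine lintegral_mono fun p => ?_
          rw [← ENNReal.ofReal_add (hc0 _ _) (hc0 _ _)]
          exact ENNReal.ofReal_le_ofReal (htri _ _ _)
      _ = ∫⁻ p, ENNReal.ofReal (c p.1.1 p.1.2) ∂Γ + ∫⁻ p, ENNReal.ofReal (c p.1.2 p.2) ∂Γ :=
          lintegral_add_left (hc'.comp measurable_fst) _
      _ = _ := by
          have e1 : ∫⁻ z, ENNReal.ofReal (c z.1 z.2) ∂Γ₁ =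
              ∫⁻ p, ENNReal.ofReal (c p.1.1 p.1.2) ∂Γ := by
            rw [← hΓ₁, lintegral_map hc' measurable_fst]
          have e2 : ∫⁻ z, ENNReal.ofReal (c z.1 z.2) ∂Γ₂ =
              ∫⁻ p, ENNReal.ofReal (c p.1.2 p.2) ∂Γ := by
            rw [← hΓ₂, lintegral_map hc' hm]
          rw [e1, e2]

variable {S : Type u} {K : ℕ}

theorem truncDist_nonneg (x y : ParamSpace K) : 0 ≤ truncDist x y :=
  le_min zero_le_one (norm_nonneg _)

theorem truncDist_le_one (x y : ParamSpace K) : truncDist x y ≤ 1 := min_le_left _ _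

theorem truncDist_triangle (x y z : ParamSpace K) :
    truncDist x z ≤ truncDist x y + truncDist y z := by
  have h := norm_sub_le_norm_sub_add_norm_sub x y z
  simp only [truncDist]
  rcases min_cases 1 ‖x - y‖ with h1 | h1 <;> rcases min_cases 1 ‖y - z‖ with h2 | h2 <;>
    rcases min_cases 1 ‖x - z‖ with h3 | h3 <;>
    linarith [norm_nonneg (x - y), norm_nonneg (y - z)]

theorem coupledDist_of_eq {z z' : ParamSpace K × S} (h : z.2 = z'.2) :
    coupledDist z z' = truncDist z.1 z'.1 := by
  simp [coupledDist, h]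

theorem coupledDist_of_ne {z z' : ParamSpace K × S} (h : z.2 ≠ z'.2) : coupledDist z z' = 1 := by
  simp [coupledDist, h]

theorem truncDist_le_coupledDist (z z' : ParamSpace K × S) :
    truncDist z.1 z'.1 ≤ coupledDist z z' := by
  by_cases h : z.2 = z'.2
  · rw [coupledDist_of_eq h]
  · rw [coupledDist_of_ne h]
    exact truncDist_le_one _ _

theorem coupledDist_nonneg (z z' : ParamSpace K × S) : 0 ≤ coupledDist z z' :=
  (truncDist_nonneg _ _).trans (truncDist_le_coupledDist z z')

theorem coupledDist_le_one (z z' : ParamSpace K × S) : coupledDist z z' ≤ 1 := by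
  by_cases h : z.2 = z'.2
  · rw [coupledDist_of_eq h]
    exact truncDist_le_one _ _
  · rw [coupledDist_of_ne h]

/-- A change of index already costs `1`, the largest possible value, so only the case of equal
indices uses the triangle inequality for `truncDist`. -/
theorem coupledDist_triangle (x y z : ParamSpace K × S) :
    coupledDist x z ≤ coupledDist x y + coupledDist y z := by
  by_cases h1 : x.2 = y.2
  · by_cases h2 : y.2 = z.2
    · rw [coupledDist_of_eq h1, coupledDist_of_eq h2, coupledDist_of_eq (h1.trans h2)]
      exact truncDist_triangle _ _ _
    · rw [coupledDist_of_ne h2]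
      linarith [coupledDist_le_one x z, coupledDist_nonneg x y]
  · rw [coupledDist_of_ne h1]
    linarith [coupledDist_le_one x z, coupledDist_nonneg y z]

variable [MeasurableSpace S]

/-- Couplings of the pairs project to couplings of the parameters, and the projection does not
increase the cost. -/
theorem wasserstein_truncDist_fst_le (μ ν : Measure (ParamSpace K × S)) :
    wasserstein truncDist μ.fst ν.fst ≤ wasserstein coupledDist μ ν := by
  refine le_iInf₂ fun Γ hΓ => ?_
  have h1 : μ.fst = Γ.map fun p => p.1.1 := by
    rw [Measure.fst, ← hΓ.1, Measure.map_map measurable_fst measurable_fst]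
    rfl
  have h2 : ν.fst = Γ.map fun p => p.2.1 := by
    rw [Measure.fst, ← hΓ.2, Measure.map_map measurable_fst measurable_snd]
    rfl
  rw [h1, h2]
  refine (wasserstein_map_le truncDist Γ measurable_fst.fst measurable_snd.fst).trans ?_
  exact lintegral_mono fun p => ENNReal.ofReal_le_ofReal (truncDist_le_coupledDist _ _)

variable [TopologicalSpace S] [PolishSpace S] [BorelSpace S]

theorem measurable_coupledDist :
    Measurable fun p : (ParamSpace K × S) × (ParamSpace K × S) => coupledDist p.1 p.2 := by
  have h1 : MeasurableSet {p : (ParamSpace K × S) × (ParamSpace K × S) | p.1.2 = p.2.2} :=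
    measurableSet_eq_fun measurable_fst.snd measurable_snd.snd
  have h2 : Measurable fun p : (ParamSpace K × S) × (ParamSpace K × S) => truncDist p.1.1 p.2.1 :=
    measurable_const.min (measurable_fst.fst.sub measurable_snd.fst).norm
  exact (Measurable.ite h1.compl measurable_const measurable_const).add
    (Measurable.ite h1 h2 measurable_const)

end Wasserstein

/-! ### The Markov semigroup of the coupled process -/

section Semigroup

variable {S : Type u} [TopologicalSpace S] [MeasurableSpace S] {K : ℕ}

/-- From `(θ, v)`, keep `θ` and sample an index path started at `v`. -/
def pathKernel (K : ℕ) (P : Kernel S (CadlagPath S)) :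
    Kernel (ParamSpace K × S) (ParamSpace K × CadlagPath S) :=
  Kernel.deterministic Prod.fst measurable_fst ×ₖ P.comap Prod.snd measurable_snd

instance {P : Kernel S (CadlagPath S)} [IsMarkovKernel P] : IsMarkovKernel (pathKernel K P) := by
  unfold pathKernel; infer_instance

theorem pathKernel_apply (P : Kernel S (CadlagPath S)) [IsMarkovKernel P] (z : ParamSpace K × S) :
    pathKernel K P z = (P z.2).map fun ω => (z.1, ω) := by
  rw [pathKernel, Kernel.prod_apply, Kernel.deterministic_apply, Kernel.comap_apply,
    Measure.dirac_prod]

/-- The transition kernel over a time `t` of the process `(θ^ε_t, V_{t/ε})`. -/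
def evolve (f : ParamSpace K → S → ℝ) (ε t : ℝ≥0) (P : Kernel S (CadlagPath S)) :
    Kernel (ParamSpace K × S) (ParamSpace K × S) :=
  (pathKernel K P).map fun p => (sgp f ε p.1 p.2 t, p.2 (t / ε))

variable [PolishSpace S] [BorelSpace S] [CompactSpace S] {f : ParamSpace K → S → ℝ} {κ : ℝ}
  {P : Kernel S (CadlagPath S)} {π : Measure S} {ε : ℝ≥0}

theorem measurable_flow (hf : IsRegularTarget f) (hconv : IsUniformlyStronglyConvex f κ)
    (ε t : ℝ≥0) : Measurable fun p : ParamSpace K × CadlagPath S =>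
      (sgp f ε p.1 p.2 t, p.2 (t / ε)) :=
  (measurable_sgp hf hconv ε t).prodMk ((CadlagPath.measurable_eval _).comp measurable_snd)

theorem measurable_flow_apply (hf : IsRegularTarget f) (hconv : IsUniformlyStronglyConvex f κ)
    (ε t : ℝ≥0) (m : ParamSpace K) : Measurable fun ω : CadlagPath S =>
      (sgp f ε m ω t, ω (t / ε)) :=
  (measurable_flow hf hconv ε t).comp measurable_prodMk_left

theorem evolve_apply (hf : IsRegularTarget f) (hconv : IsUniformlyStronglyConvex f κ)
    [IsMarkovKernel P] (t : ℝ≥0) (z : ParamSpace K × S) :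
    evolve f ε t P z = coupledLaw f ε t z.1 (P z.2) := by
  rw [evolve, Kernel.map_apply _ (measurable_flow hf hconv ε t), pathKernel_apply,
    Measure.map_map (measurable_flow hf hconv ε t) measurable_prodMk_left]
  rfl

theorem isMarkovKernel_evolve (hf : IsRegularTarget f) (hconv : IsUniformlyStronglyConvex f κ)
    [IsMarkovKernel P] (ε t : ℝ≥0) : IsMarkovKernel (evolve f ε t P) := by
  unfold evolve
  exact Kernel.IsMarkovKernel.map _ (measurable_flow hf hconv ε t)

theorem isProbabilityMeasure_coupledLaw (hf : IsRegularTarget f)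
    (hconv : IsUniformlyStronglyConvex f κ) (t : ℝ≥0) (m : ParamSpace K)
    (Q : Measure (CadlagPath S)) [IsProbabilityMeasure Q] :
    IsProbabilityMeasure (coupledLaw f ε t m Q) :=
  Measure.isProbabilityMeasure_map (measurable_flow_apply hf hconv ε t m).aemeasurable

theorem coupledLaw_fst (hf : IsRegularTarget f) (hconv : IsUniformlyStronglyConvex f κ)
    (t : ℝ≥0) (m : ParamSpace K) (Q : Measure (CadlagPath S)) :
    (coupledLaw f ε t m Q).fst = sgpLaw f ε t m Q :=
  Measure.map_map measurable_fst (measurable_flow_apply hf hconv ε t m)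

/-- The solution at time `t` is unchanged when the index path is stopped at `t / ε`. -/
theorem measurable_sgp_canonicalFiltration (hf : IsRegularTarget f)
    (hconv : IsUniformlyStronglyConvex f κ) (ε t : ℝ≥0) (m : ParamSpace K) :
    Measurable[canonicalFiltration S (t / ε)] fun ω : CadlagPath S => sgp f ε m ω t := by
  have h1 : (fun ω : CadlagPath S => sgp f ε m ω t) =
      (fun ω : CadlagPath S => sgp f ε m ω t) ∘ CadlagPath.stopAt (t / ε) := by
    funext ω
    exact sgp_congr hf hconv ε m fun s hs => (CadlagPath.stopAt_apply_of_le hs ω).symm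
  have h2 : Measurable fun ω : CadlagPath S => sgp f ε m ω t :=
    (measurable_sgp hf hconv ε t).comp measurable_prodMk_left
  rw [h1]
  exact h2.comp (CadlagPath.measurable_stopAt (t / ε))

/-- The event that the parameter at time `s` lies in `A` belongs to the past at `s / ε`, so the
Markov property on path space applies on it; rectangles then determine the joint law. -/
theorem map_sgp_shift (hf : IsRegularTarget f) (hconv : IsUniformlyStronglyConvex f κ)
    (hP : IsFellerProcess P) [IsProbabilityMeasure π] (s : ℝ≥0) (m : ParamSpace K) :
    (lawFrom P π).map (fun ω : CadlagPath S => (sgp f ε m ω s, ω.shift (s / ε))) =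
      (coupledLaw f ε s m (lawFrom P π)).bind (pathKernel K P) := by
  have : IsMarkovKernel P := ⟨hP.isProbability⟩
  have hθ : Measurable fun ω : CadlagPath S => sgp f ε m ω s :=
    (measurable_sgp hf hconv ε s).comp measurable_prodMk_left
  have hsh := CadlagPath.measurable_shift (S := S) (s / ε)
  have hev := CadlagPath.measurable_eval (S := S) (s / ε)
  refine Measure.ext_prod fun {A E} hA hE => ?_
  have hB : MeasurableSet[canonicalFiltration S (s / ε)]
      ((fun ω : CadlagPath S => sgp f ε m ω s) ⁻¹' A) :=
    measurable_sgp_canonicalFiltration hf hconv ε s m hA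
  have h1 := congrArg (fun ν : Measure (CadlagPath S) => ν E)
    ((lawFrom_isMarkovWith hP π).map_shift (X := id) hP measurable_id (s / ε) hB)
  have h2 : ∀ z : ParamSpace K × S, pathKernel K P z (A ×ˢ E) =
      A.indicator (fun _ => P z.2 E) z.1 := fun z => by
    rw [pathKernel_apply, Measure.map_apply measurable_prodMk_left (hA.prod hE)]
    by_cases hz : z.1 ∈ A
    · simp [hz, mk_preimage_prod_right]
    · simp [hz, mk_preimage_prod_right_eq_empty]
  have h3 : Measurable fun z : ParamSpace K × S => A.indicator (fun _ => P z.2 E) z.1 := by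
    have := (pathKernel K P).measurable_coe (hA.prod hE)
    simpa only [h2] using this
  rw [Measure.map_apply (hθ.prodMk hsh) (hA.prod hE),
    Measure.bind_apply (hA.prod hE) (pathKernel K P).aemeasurable]
  simp_rw [h2]
  rw [coupledLaw, lintegral_map h3 (hθ.prodMk hev)]
  have h4 : ∫⁻ ω, A.indicator (fun _ => P (ω (s / ε)) E) (sgp f ε m ω s) ∂(lawFrom P π) =
      ∫⁻ ω in (fun ω : CadlagPath S => sgp f ε m ω s) ⁻¹' A, P (ω (s / ε)) E ∂(lawFrom P π) := by
    rw [← lintegral_indicator (hθ hA)]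
    rfl
  refine Eq.trans ?_ h4.symm
  rw [Measure.bind_apply hE P.aemeasurable] at h1
  have h5 := lintegral_map (μ := (lawFrom P π).restrict
    ((fun ω : CadlagPath S => sgp f ε m ω s) ⁻¹' A)) (P.measurable_coe hE) hev
  rw [← h5]
  refine Eq.trans ?_ h1
  change _ = (((lawFrom P π).restrict _).map (CadlagPath.shift (s / ε))) E
  rw [Measure.map_apply hsh hE, Measure.restrict_apply (hsh hE), inter_comm]
  rfl

/-- The Chapman-Kolmogorov equation for the coupled process. -/
theorem coupledLaw_add (hf : IsRegularTarget f) (hconv : IsUniformlyStronglyConvex f κ)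
    (hP : IsFellerProcess P) [IsProbabilityMeasure π] (s t : ℝ≥0) (m : ParamSpace K) :
    coupledLaw f ε (s + t) m (lawFrom P π) =
      (coupledLaw f ε s m (lawFrom P π)).bind (evolve f ε t P) := by
  have hθ : Measurable fun ω : CadlagPath S => sgp f ε m ω s :=
    (measurable_sgp hf hconv ε s).comp measurable_prodMk_left
  have hsh := CadlagPath.measurable_shift (S := S) (s / ε)
  have h1 := congrArg (fun ν => ν.map fun p : ParamSpace K × CadlagPath S =>
    (sgp f ε p.1 p.2 t, p.2 (t / ε))) (map_sgp_shift (ε := ε) (π := π) hf hconv hP s m)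
  rw [Measure.map_map (measurable_flow hf hconv ε t) (hθ.prodMk hsh),
    Measure.map_comp _ _ (measurable_flow hf hconv ε t)] at h1
  refine Eq.trans ?_ h1
  refine congrArg (fun g => (lawFrom P π).map g) (funext fun ω => ?_)
  simp only [Function.comp_apply, CadlagPath.shift_apply]
  rw [sgp_add hf hconv, add_div]

/-! ### Test functions which are Lipschitz in the parameter -/

/-- Bounded measurable functions of `(θ, v)` which are Lipschitz in `θ`. -/
structure IsLipschitzTest (g : ParamSpace K × S → ℝ) (c L : ℝ) : Prop where
  measurable : Measurable g
  abs_le : ∀ z, |g z| ≤ c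
  lipschitz : ∀ u u' v, |g (u, v) - g (u', v)| ≤ L * ‖u - u'‖

omit [TopologicalSpace S] [PolishSpace S] [BorelSpace S] [CompactSpace S] in
theorem IsLipschitzTest.integrable {g : ParamSpace K × S → ℝ} {c L : ℝ}
    (hg : IsLipschitzTest g c L) (μ : Measure (ParamSpace K × S)) [IsFiniteMeasure μ] :
    Integrable g μ :=
  Integrable.of_measurable_of_abs_le hg.measurable hg.abs_le

theorem integral_evolve (hf : IsRegularTarget f) (hconv : IsUniformlyStronglyConvex f κ)
    [IsMarkovKernel P] (t : ℝ≥0) {g : ParamSpace K × S → ℝ} (hg : Measurable g) (u : ParamSpace K)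
    (v : S) : ∫ z, g z ∂(evolve f ε t P (u, v)) =
      ∫ ω, g (sgp f ε u ω t, ω (t / ε)) ∂(P v) := by
  rw [evolve_apply hf hconv, coupledLaw,
    integral_map (measurable_flow_apply hf hconv ε t u).aemeasurable hg.aestronglyMeasurable]

theorem IsLipschitzTest.integral_evolve_sub_le (hf : IsRegularTarget f)
    (hconv : IsUniformlyStronglyConvex f κ) [IsMarkovKernel P] (t : ℝ≥0)
    {g : ParamSpace K × S → ℝ} {c L : ℝ} (hL : 0 ≤ L) (hg : IsLipschitzTest g c L)
    (u u' : ParamSpace K) (v : S) :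
    |∫ z, g z ∂(evolve f ε t P (u, v)) - ∫ z, g z ∂(evolve f ε t P (u', v))| ≤
      L * (Real.exp (-κ * t) * ‖u - u'‖) := by
  have hi : ∀ u, Integrable (fun ω : CadlagPath S => g (sgp f ε u ω t, ω (t / ε))) (P v) := fun u =>
    Integrable.of_measurable_of_abs_le (hg.measurable.comp (measurable_flow_apply hf hconv ε t u))
      fun ω => hg.abs_le _
  rw [integral_evolve hf hconv t hg.measurable, integral_evolve hf hconv t hg.measurable,
    ← integral_sub (hi u) (hi u')]
  have h1 := norm_integral_le_of_norm_le_const (μ := P v)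
    (f := fun ω : CadlagPath S => g (sgp f ε u ω t, ω (t / ε)) - g (sgp f ε u' ω t, ω (t / ε)))
    (C := L * (Real.exp (-κ * t) * ‖u - u'‖)) (Eventually.of_forall fun ω => by
      refine (hg.lipschitz _ _ _).trans ?_
      gcongr
      exact norm_sgp_sub_sgp_le hf hconv ε u u' ω t)
  rw [probReal_univ, mul_one] at h1
  exact h1

/-- The contraction keeps the constants, so the test class is stable under the semigroup without any
continuity in the index. -/
theorem IsLipschitzTest.evolve (hf : IsRegularTarget f) (hconv : IsUniformlyStronglyConvex f κ)
    (hκ : 0 ≤ κ) [IsMarkovKernel P] (t : ℝ≥0) {g : ParamSpace K × S → ℝ} {c L : ℝ} (hL : 0 ≤ L)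
    (hg : IsLipschitzTest g c L) :
    IsLipschitzTest (fun z => ∫ z', g z' ∂(evolve f ε t P z)) c L := by
  have := isMarkovKernel_evolve (P := P) hf hconv ε t
  refine ⟨?_, fun z => ?_, fun u u' v => ?_⟩
  · exact (hg.measurable.stronglyMeasurable.integral_kernel (κ := _root_.evolve f ε t P)).measurable
  · have h1 := norm_integral_le_of_norm_le_const (μ := _root_.evolve f ε t P z) (f := g)
      (Eventually.of_forall fun z => hg.abs_le z)
    rw [probReal_univ, mul_one] at h1
    exact h1
  · refine (hg.integral_evolve_sub_le hf hconv t hL u u' v).trans ?_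
    gcongr
    refine mul_le_of_le_one_left (norm_nonneg _) (Real.exp_le_one_iff.2 ?_)
    have := t.coe_nonneg
    nlinarith

-- Thickened indicators of a closed `F`, multiplied by the indicator of a measurable `A`, are tests
-- that decrease to the indicator of `F ×ˢ A`; such rectangles determine the measure.
omit [TopologicalSpace S] [PolishSpace S] [CompactSpace S] [BorelSpace S] in
theorem ext_of_isLipschitzTest {μ ν : Measure (ParamSpace K × S)} [IsProbabilityMeasure μ]
    [IsProbabilityMeasure ν]
    (h : ∀ g c L, 0 ≤ L → IsLipschitzTest g c L → ∫ z, g z ∂μ = ∫ z, g z ∂ν) : μ = ν := by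
  refine ext_of_generate_finite (image2 (· ×ˢ ·) {F | IsClosed F} {A | MeasurableSet A}) ?_ ?_ ?_
    (by simp)
  · refine (generateFrom_eq_prod ?_ MeasurableSpace.generateFrom_measurableSet
      ⟨fun _ => univ, fun _ => isClosed_univ, iUnion_const _⟩
      isCountablySpanning_measurableSet).symm
    exact borel_eq_generateFrom_isClosed.symm.trans
      (BorelSpace.measurable_eq (α := ParamSpace K)).symm
  · exact isPiSystem_isClosed.prod MeasurableSpace.isPiSystem_measurableSet
  · rintro _ ⟨F, hF, A, hA, rfl⟩
    have hδ : ∀ n : ℕ, (0 : ℝ) < 1 / ((n : ℝ) + 1) := fun n => by positivity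
    let φ : ℕ → ParamSpace K → ℝ≥0 := fun n => thickenedIndicator (hδ n) F
    let g : ℕ → ParamSpace K × S → ℝ := fun n z => φ n z.1 * A.indicator 1 z.2
    have hA1 : ∀ v, |A.indicator (1 : S → ℝ) v| ≤ 1 := fun v => by
      by_cases hv : v ∈ A <;> simp [hv]
    have hφ1 : ∀ n u, (φ n u : ℝ) ≤ 1 := fun n u => by
      have h1 : φ n u ≤ 1 := thickenedIndicator_le_one (hδ n) F u
      exact_mod_cast h1
    have hg : ∀ n, IsLipschitzTest (g n) 1 ((1 / ((n : ℝ) + 1)).toNNReal⁻¹ : ℝ≥0) := fun n => by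
      refine ⟨?_, fun z => ?_, fun u u' v => ?_⟩
      · exact ((thickenedIndicator (hδ n) F).continuous.measurable.comp
          measurable_fst).coe_nnreal_real.mul ((measurable_one.indicator hA).comp measurable_snd)
      · rw [abs_mul, abs_of_nonneg (NNReal.coe_nonneg _)]
        exact mul_le_one₀ (hφ1 n _) (abs_nonneg _) (hA1 _)
      · simp only [g]
        rw [← sub_mul, abs_mul]
        refine (mul_le_of_le_one_right (abs_nonneg _) (hA1 v)).trans ?_
        have := (lipschitzWith_thickenedIndicator (hδ n) F).dist_le_mul u u'
        rwa [dist_eq_norm] at this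
    have hlim : ∀ ρ : Measure (ParamSpace K × S), IsProbabilityMeasure ρ →
        Tendsto (fun n => ∫ z, g n z ∂ρ) atTop (𝓝 (ρ.real (F ×ˢ A))) := fun ρ _ => by
      rw [← integral_indicator_one (hF.measurableSet.prod hA)]
      refine tendsto_integral_of_dominated_convergence (fun _ => 1)
        (fun n => (hg n).measurable.aestronglyMeasurable) (integrable_const _)
        (fun n => Eventually.of_forall (hg n).abs_le) (Eventually.of_forall fun z => ?_)
      have h1 := tendsto_pi_nhds.1 (thickenedIndicator_tendsto_indicator_closure hδ
        tendsto_one_div_add_atTop_nhds_zero_nat F) z.1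
      have h2 := ((NNReal.continuous_coe.tendsto _).comp h1).mul_const (A.indicator (1 : S → ℝ) z.2)
      refine h2.trans_eq ?_
      rw [hF.closure_eq]
      by_cases hu : z.1 ∈ F <;> by_cases hv : z.2 ∈ A <;> simp [hu, hv]
    have h3 := tendsto_nhds_unique (hlim μ inferInstance)
      ((hlim ν inferInstance).congr fun n => (h _ _ _ (NNReal.coe_nonneg _) (hg n)).symm)
    exact (measureReal_eq_measureReal_iff).1 h3

end Semigroup

/-! ### Stationary law and convergence -/

section Stationary

variable {S : Type u} [TopologicalSpace S] [PolishSpace S] [CompactSpace S] [MeasurableSpace S]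
  [BorelSpace S] {K : ℕ} {f : ParamSpace K → S → ℝ} {κ : ℝ} {P : Kernel S (CadlagPath S)}
  {π : Measure S} {ε : ℝ≥0} {m : ParamSpace K} {R : ℝ}

/-- Pairs of states with the same index and parameters at distance at most `r`. -/
def nearSet (S : Type u) (K : ℕ) (r : ℝ) : Set ((ParamSpace K × S) × (ParamSpace K × S)) :=
  {p | p.1.2 = p.2.2 ∧ ‖p.1.1 - p.2.1‖ ≤ r}

omit [CompactSpace S] [MeasurableSpace S] [BorelSpace S] in
theorem isClosed_nearSet (r : ℝ) : IsClosed (nearSet S K r) :=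
  (isClosed_eq (continuous_snd.comp continuous_fst) (continuous_snd.comp continuous_snd)).inter
    (isClosed_le ((continuous_fst.comp continuous_fst).sub
      (continuous_fst.comp continuous_snd)).norm continuous_const)

/-- `μ` and `ν` have a coupling which keeps the index equal and the parameters at distance at most
`r`. -/
def AreNear (r : ℝ) (μ ν : Measure (ParamSpace K × S)) : Prop :=
  ∃ Γ : Measure ((ParamSpace K × S) × (ParamSpace K × S)),
    Γ.map Prod.fst = μ ∧ Γ.map Prod.snd = ν ∧ ∀ᵐ p ∂Γ, p ∈ nearSet S K r

/-- Both processes are built from one stationary path. The solution restarted from `m` along the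
path shifted by `s / ε` has the law at time `t`, and over that time it contracts towards the
unshifted solution, from an initial distance of at most `2 R`. -/
theorem areNear_coupledLaw (hf : IsRegularTarget f) (hconv : IsUniformlyStronglyConvex f κ)
    (hP : IsFellerProcess P) (hπ : IsInvariantLaw P π)
    (hR : ∀ (ω : CadlagPath S) t, ‖sgp f ε m ω t‖ ≤ R) (hm : ‖m‖ ≤ R) (s t : ℝ≥0) :
    AreNear (2 * R * Real.exp (-κ * t)) (coupledLaw f ε t m (lawFrom P π))
      (coupledLaw f ε (s + t) m (lawFrom P π)) := by
  have hsh := CadlagPath.measurable_shift (S := S) (s / ε)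
  have h1 := measurable_flow_apply hf hconv ε t m
  have h2 := measurable_flow_apply hf hconv ε (s + t) m
  have hU : Measurable fun ω : CadlagPath S =>
      ((sgp f ε m (ω.shift (s / ε)) t, ω.shift (s / ε) (t / ε)),
        (sgp f ε m ω (s + t), ω ((s + t) / ε))) := (h1.comp hsh).prodMk h2
  refine ⟨(lawFrom P π).map fun ω : CadlagPath S =>
    ((sgp f ε m (ω.shift (s / ε)) t, ω.shift (s / ε) (t / ε)),
      (sgp f ε m ω (s + t), ω ((s + t) / ε))), ?_, ?_, ?_⟩
  · have h3 := Measure.map_map (μ := lawFrom P π) h1 hsh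
    rw [hπ.lawFrom_map_shift hP] at h3
    exact (Measure.map_map measurable_fst hU).trans h3.symm
  · exact Measure.map_map measurable_snd hU
  · refine (ae_map_iff hU.aemeasurable (isClosed_nearSet _).measurableSet).2
      (Eventually.of_forall fun ω => ⟨?_, ?_⟩)
    · simp only [CadlagPath.shift_apply, add_div]
    · simp only
      rw [sgp_add hf hconv]
      refine (norm_sgp_sub_sgp_le hf hconv ε _ _ _ t).trans ?_
      rw [mul_comm]
      gcongr
      exact (norm_sub_le _ _).trans (by linarith [hR ω s])

/-- The laws of the process started from `(m, π)` converge to a probability measure. -/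
theorem exists_limit_coupledLaw (hf : IsRegularTarget f) (hconv : IsUniformlyStronglyConvex f κ)
    (hP : IsFellerProcess P) (hπ : IsInvariantLaw P π)
    (hR : ∀ (ω : CadlagPath S) t, ‖sgp f ε m ω t‖ ≤ R) (hm : ‖m‖ ≤ R) :
    ∃ M : Measure (ParamSpace K × S), IsProbabilityMeasure M ∧ ∀ t : ℝ≥0,
      AreNear (2 * R * Real.exp (-κ * t)) (coupledLaw f ε t m (lawFrom P π)) M := by
  have := hπ.1
  have : IsMarkovKernel P := ⟨hP.isProbability⟩
  set B : Set (ParamSpace K × S) := Metric.closedBall 0 R ×ˢ univ with hBdef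
  have hBc : IsCompact B := (isCompact_closedBall 0 R).prod isCompact_univ
  have hB0 : ∀ t, coupledLaw f ε t m (lawFrom P π) Bᶜ = 0 := fun t => by
    rw [coupledLaw, Measure.map_apply (measurable_flow_apply hf hconv ε t m)
      hBc.measurableSet.compl]
    convert measure_empty (μ := lawFrom P π)
    refine eq_empty_of_forall_notMem fun ω hω => hω ⟨?_, mem_univ _⟩
    simpa using hR ω t
  let H : ℝ≥0 → ProbabilityMeasure (ParamSpace K × S) := fun t =>
    ⟨coupledLaw f ε t m (lawFrom P π), isProbabilityMeasure_coupledLaw hf hconv t m _⟩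
  -- Prokhorov for measures carried by one compact set, in ultrafilter form. It is used for the laws
  -- and again for their couplings, with the same ultrafilter so that the limits are compatible.
  have hcpt : ∀ {Y : Type u} [TopologicalSpace Y] [PolishSpace Y] [MeasurableSpace Y] [BorelSpace Y]
      {A : Set Y} (_ : IsCompact A) (U : Ultrafilter ℕ) (ν : ℕ → ProbabilityMeasure Y)
      (_ : ∀ᶠ n in (U : Filter ℕ), (ν n : Measure Y) Aᶜ = 0),
      ∃ ν', Tendsto ν (U : Filter ℕ) (𝓝 ν') := by
    intro Y _ _ _ _ A hA U ν hν
    have hc := isCompact_setOfPred_probabilityMeasure_mass_eq_compl_isCompact_le (u := fun _ => 0)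
      (K := fun _ : ℕ => A) tendsto_const_nhds (fun _ => hA) (Or.inr monotone_const)
    obtain ⟨ν', -, h'⟩ := hc.ultrafilter_le_nhds (U.map ν) (by
      rw [le_principal_iff]
      refine Filter.mem_map.2 (hν.mono fun n hn => ?_)
      simp [ProbabilityMeasure.coeFn_def, hn])
    exact ⟨ν', h'⟩
  let U : Ultrafilter ℕ := Ultrafilter.of atTop
  have hU : (U : Filter ℕ) ≤ atTop := Ultrafilter.of_le _
  obtain ⟨M, hM⟩ := hcpt hBc U (fun n => H n) (Eventually.of_forall fun n => hB0 n)
  refine ⟨M, inferInstance, fun t => ?_⟩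
  -- The subtraction is truncated; once `n ≥ t` the second marginal is the law at time `n`, which
  -- suffices along the ultrafilter.
  have hnear := fun n : ℕ => areNear_coupledLaw hf hconv hP hπ hR hm ((n : ℝ≥0) - t) t
  choose Γ hΓ₁ hΓ₂ hΓ using hnear
  have hΓp : ∀ n, IsProbabilityMeasure (Γ n) := fun n => by
    have := isProbabilityMeasure_coupledLaw (ε := ε) hf hconv t m (lawFrom P π)
    rw [← hΓ₁ n] at this
    exact ⟨by rw [← measure_univ (μ := (Γ n).map Prod.fst), Measure.map_apply measurable_fst .univ,
      preimage_univ]⟩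
  let G : ℕ → ProbabilityMeasure ((ParamSpace K × S) × (ParamSpace K × S)) := fun n => ⟨Γ n, hΓp n⟩
  obtain ⟨G', hG'⟩ := hcpt (hBc.prod hBc) U G (Eventually.of_forall fun n => by
    have h1 : Γ n (Prod.fst ⁻¹' Bᶜ) = 0 := by
      rw [← Measure.map_apply measurable_fst hBc.measurableSet.compl, hΓ₁]
      exact hB0 t
    have h2 : Γ n (Prod.snd ⁻¹' Bᶜ) = 0 := by
      rw [← Measure.map_apply measurable_snd hBc.measurableSet.compl, hΓ₂]
      exact hB0 _
    refine measure_mono_null (t := Prod.fst ⁻¹' Bᶜ ∪ Prod.snd ⁻¹' Bᶜ) ?_ (measure_union_null h1 h2)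
    intro p hp
    by_contra! h3
    simp only [mem_union, mem_preimage, mem_compl_iff, not_or, not_not] at h3
    exact hp ⟨h3.1, h3.2⟩)
  refine ⟨G', ?_, ?_, ?_⟩
  · have h1 := ProbabilityMeasure.tendsto_map_of_tendsto_of_continuous _ _ hG' continuous_fst
    have h2 : ∀ n, (G n).map measurable_fst.aemeasurable = H t := fun n => Subtype.ext (hΓ₁ n)
    simp_rw [h2] at h1
    have h3 : G'.map measurable_fst.aemeasurable = H t := tendsto_nhds_unique h1 tendsto_const_nhds
    exact congrArg (fun ν : ProbabilityMeasure (ParamSpace K × S) => (ν : Measure (ParamSpace K × S))) h3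
  · have h1 := ProbabilityMeasure.tendsto_map_of_tendsto_of_continuous _ _ hG' continuous_snd
    have h2 : ∀ᶠ n in (U : Filter ℕ), (G n).map measurable_snd.aemeasurable = H n := by
      obtain ⟨N, hN⟩ := exists_nat_ge t
      filter_upwards [hU (eventually_ge_atTop N)] with n hn
      refine Subtype.ext ((hΓ₂ n).trans ?_)
      rw [tsub_add_cancel_of_le (hN.trans (by exact_mod_cast hn))]
    have h3 : G'.map measurable_snd.aemeasurable = M :=
      tendsto_nhds_unique h1 (hM.congr' (h2.mono fun n hn => hn.symm))
    exact congrArg (fun ν : ProbabilityMeasure (ParamSpace K × S) => (ν : Measure (ParamSpace K × S))) h3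
  · have h1 := ProbabilityMeasure.limsup_measure_closed_le_of_tendsto hG'
      (isClosed_nearSet (S := S) (K := K) (2 * R * Real.exp (-κ * t)))
    have h2 : ∀ n, (G n : Measure _) (nearSet S K (2 * R * Real.exp (-κ * t))) = 1 := fun n =>
      (prob_compl_eq_zero_iff (isClosed_nearSet _).measurableSet).1 (hΓ n)
    simp_rw [h2, limsup_const] at h1
    exact (prob_compl_eq_zero_iff (isClosed_nearSet _).measurableSet).2
      (le_antisymm prob_le_one h1)

omit [TopologicalSpace S] [PolishSpace S] [CompactSpace S] [BorelSpace S] in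
theorem AreNear.integral_sub_le {r : ℝ} {μ ν : Measure (ParamSpace K × S)}
    [IsProbabilityMeasure μ] (h : AreNear r μ ν) {g : ParamSpace K × S → ℝ} {c L : ℝ} (hL : 0 ≤ L)
    (hg : IsLipschitzTest g c L) : |∫ z, g z ∂μ - ∫ z, g z ∂ν| ≤ L * r := by
  obtain ⟨Γ, rfl, rfl, hΓ⟩ := h
  have : IsProbabilityMeasure Γ := ⟨by
    rw [← measure_univ (μ := Γ.map Prod.fst), Measure.map_apply measurable_fst .univ,
      preimage_univ]⟩
  have hi : ∀ φ : (ParamSpace K × S) × (ParamSpace K × S) → ParamSpace K × S, Measurable φ →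
      Integrable (fun p => g (φ p)) Γ := fun φ hφ =>
    Integrable.of_measurable_of_abs_le (hg.measurable.comp hφ) fun p => hg.abs_le _
  rw [integral_map measurable_fst.aemeasurable hg.measurable.aestronglyMeasurable,
    integral_map measurable_snd.aemeasurable hg.measurable.aestronglyMeasurable,
    ← integral_sub (hi _ measurable_fst) (hi _ measurable_snd)]
  have h1 := norm_integral_le_of_norm_le_const (μ := Γ) (f := fun p => g p.1 - g p.2) (C := L * r)
    (hΓ.mono fun p hp => by
      have h2 : p.2 = (p.2.1, p.1.2) := Prod.ext rfl hp.1.symm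
      rw [h2]
      exact (hg.lipschitz p.1.1 p.2.1 p.1.2).trans (by gcongr; exact hp.2))
  rw [probReal_univ, mul_one] at h1
  exact h1

omit [TopologicalSpace S] [PolishSpace S] [CompactSpace S] [BorelSpace S] in
theorem AreNear.wasserstein_le {r : ℝ} {μ ν : Measure (ParamSpace K × S)}
    [IsProbabilityMeasure μ] (h : AreNear r μ ν) :
    wasserstein coupledDist μ ν ≤ ENNReal.ofReal r := by
  obtain ⟨Γ, rfl, rfl, hΓ⟩ := h
  have : IsProbabilityMeasure Γ := ⟨by
    rw [← measure_univ (μ := Γ.map Prod.fst), Measure.map_apply measurable_fst .univ,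
      preimage_univ]⟩
  refine (wasserstein_map_le coupledDist Γ measurable_fst measurable_snd).trans ?_
  calc _ ≤ ∫⁻ _, ENNReal.ofReal r ∂Γ := lintegral_mono_ae (hΓ.mono fun p hp => by
        refine ENNReal.ofReal_le_ofReal ?_
        rw [coupledDist_of_eq hp.1]
        exact (min_le_right _ _).trans hp.2)
    _ = _ := by simp

theorem tendsto_exp_neg_mul_nat (hκ : 0 < κ) :
    Tendsto (fun n : ℕ => Real.exp (-κ * ((n : ℝ≥0) : ℝ))) atTop (𝓝 0) := by
  refine Real.tendsto_exp_atBot.comp ?_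
  simp only [NNReal.coe_natCast]
  exact (tendsto_natCast_atTop_atTop (R := ℝ)).const_mul_atTop_of_neg (neg_neg_of_pos hκ)

theorem isStationaryLaw_iff (hf : IsRegularTarget f) (hconv : IsUniformlyStronglyConvex f κ)
    [IsMarkovKernel P] {M : Measure (ParamSpace K × S)} :
    IsStationaryLaw f ε P M ↔ IsProbabilityMeasure M ∧ ∀ t, M.bind (evolve f ε t P) = M := by
  refine and_congr_right fun _ => forall_congr' fun t => ?_
  rw [Measure.ext_iff]
  refine forall_congr' fun B => forall_congr' fun hB => ?_
  rw [Measure.bind_apply hB (evolve f ε t P).aemeasurable]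
  simp_rw [evolve_apply hf hconv]

/-- Limits of the laws of the process started from `(m, π)` are stationary. -/
theorem isStationaryLaw_of_areNear (hf : IsRegularTarget f) (hconv : IsUniformlyStronglyConvex f κ)
    (hκ : 0 < κ) (hP : IsFellerProcess P) (hπ : IsInvariantLaw P π)
    {M : Measure (ParamSpace K × S)} [IsProbabilityMeasure M]
    (hM : ∀ t : ℝ≥0, AreNear (2 * R * Real.exp (-κ * t)) (coupledLaw f ε t m (lawFrom P π)) M) :
    IsStationaryLaw f ε P M := by
  have := hπ.1
  have : IsMarkovKernel P := ⟨hP.isProbability⟩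
  rw [isStationaryLaw_iff hf hconv]
  refine ⟨inferInstance, fun t => ?_⟩
  have := isMarkovKernel_evolve (P := P) hf hconv ε t
  refine ext_of_isLipschitzTest fun g c L hL hg => ?_
  rw [integral_bind_kernel _ _ (hg.integrable _)]
  set g' : ParamSpace K × S → ℝ := fun z => ∫ z', g z' ∂(evolve f ε t P z) with hg'
  have hg't : IsLipschitzTest g' c L := hg.evolve hf hconv hκ.le t hL
  -- By Chapman-Kolmogorov, testing `g'` at time `n` equals testing `g` at time `n + t`; both laws
  -- are close to `M`.
  have hb : ∀ n : ℕ, |∫ z, g' z ∂M - ∫ z, g z ∂M| ≤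
      L * (2 * R * Real.exp (-κ * (n : ℝ≥0))) + L * (2 * R * Real.exp (-κ * ((n : ℝ≥0) + t : ℝ≥0))) := by
    intro n
    have hp1 := isProbabilityMeasure_coupledLaw (ε := ε) hf hconv n m (lawFrom P π)
    have hp2 := isProbabilityMeasure_coupledLaw (ε := ε) hf hconv (n + t) m (lawFrom P π)
    have h1 := (hM n).integral_sub_le hL hg't
    have h2 := (hM (n + t)).integral_sub_le hL hg
    have h3 : ∫ z, g z ∂(coupledLaw f ε (n + t) m (lawFrom P π)) =
        ∫ z, g' z ∂(coupledLaw f ε n m (lawFrom P π)) := by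
      rw [coupledLaw_add hf hconv hP, integral_bind_kernel _ _ (hg.integrable _)]
    rw [h3] at h2
    rw [abs_sub_comm] at h1
    exact (abs_sub_le _ _ _).trans (add_le_add h1 h2)
  have hlim : Tendsto (fun n : ℕ => L * (2 * R * Real.exp (-κ * (n : ℝ≥0))) +
      L * (2 * R * Real.exp (-κ * ((n : ℝ≥0) + t : ℝ≥0)))) atTop (𝓝 0) := by
    have h1 := tendsto_exp_neg_mul_nat hκ
    have h2 := h1.mul_const (Real.exp (-κ * t))
    have h3 : ∀ n : ℕ, Real.exp (-κ * ((n : ℝ≥0) + t : ℝ≥0)) =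
        Real.exp (-κ * (n : ℝ≥0)) * Real.exp (-κ * t) := fun n => by
      rw [← Real.exp_add, NNReal.coe_add, mul_add]
    simp_rw [h3]
    simpa using ((h1.const_mul (2 * R)).const_mul L).add ((h2.const_mul (2 * R)).const_mul L)
  exact sub_eq_zero.1 (abs_nonpos_iff.1 (ge_of_tendsto' hlim hb))

/-- Stationarity at time `ε t` of the coupled process is invariance at time `t` of the index, which
requires `ε ≠ 0`. -/
theorem isInvariantLaw_snd (hf : IsRegularTarget f) (hconv : IsUniformlyStronglyConvex f κ)
    (hP : IsFellerProcess P) (hε : 0 < ε) {M : Measure (ParamSpace K × S)}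
    (hM : IsStationaryLaw f ε P M) : IsInvariantLaw P M.snd := by
  have := hM.1
  have : IsMarkovKernel P := ⟨hP.isProbability⟩
  refine ⟨inferInstance, fun t => ?_⟩
  ext A hA
  rw [Measure.bind_apply hA (transition P t).aemeasurable,
    Measure.snd_apply hA, ← hM.2 (ε * t) _ (measurable_snd hA), Measure.snd,
    lintegral_map ((transition P t).measurable_coe hA) measurable_snd]
  refine lintegral_congr fun z => ?_
  rw [transition_apply', Measure.map_apply (CadlagPath.measurable_eval t) hA, coupledLaw,
    Measure.map_apply (measurable_flow_apply hf hconv ε _ _) (measurable_snd hA),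
    mul_div_cancel_left₀ _ hε.ne']
  rfl

/-- Every stationary law of the coupled process is the limit of the laws of the process started
from `(m, π)`. -/
theorem IsStationaryLaw.eq_of_areNear (hf : IsRegularTarget f)
    (hconv : IsUniformlyStronglyConvex f κ) (hκ : 0 < κ) (hP : IsFellerProcess P)
    (hπ : IsInvariantLaw P π) (huniq : ∀ π', IsInvariantLaw P π' → π' = π) (hε : 0 < ε)
    {M M' : Measure (ParamSpace K × S)} [IsProbabilityMeasure M]
    (hM : ∀ t : ℝ≥0, AreNear (2 * R * Real.exp (-κ * t)) (coupledLaw f ε t m (lawFrom P π)) M)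
    (hM' : IsStationaryLaw f ε P M') : M' = M := by
  have := hπ.1
  have := hM'.1
  have : IsMarkovKernel P := ⟨hP.isProbability⟩
  have hsnd : M'.snd = π := huniq _ (isInvariantLaw_snd hf hconv hP hε hM')
  refine ext_of_isLipschitzTest fun g c L hL hg => ?_
  have hex := tendsto_exp_neg_mul_nat hκ
  have hlim1 : Tendsto (fun n : ℕ => ∫ z, g z ∂(coupledLaw f ε n m (lawFrom P π))) atTop
      (𝓝 (∫ z, g z ∂M)) := by
    rw [tendsto_iff_norm_sub_tendsto_zero]
    have hlim := (hex.const_mul (2 * R)).const_mul L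
    rw [mul_zero, mul_zero] at hlim
    refine squeeze_zero (fun _ => norm_nonneg _) (fun n => ?_) hlim
    have hp1 := isProbabilityMeasure_coupledLaw (ε := ε) hf hconv n m (lawFrom P π)
    exact (hM n).integral_sub_le hL hg
  let q : ℕ → ParamSpace K × S → ℝ := fun n z => ∫ z', g z' ∂(evolve f ε n P z)
  have hq : ∀ n, IsLipschitzTest (q n) c L := fun n => hg.evolve hf hconv hκ.le n hL
  have hqm : ∀ n, Measurable fun z : ParamSpace K × S => q n (m, z.2) := fun n =>
    (hq n).measurable.comp (measurable_const.prodMk measurable_snd)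
  -- As `M'` has index marginal `π`, starting from `(m, π)` amounts to starting from `M'` with the
  -- parameter reset to `m`.
  have h1 : ∀ n : ℕ, ∫ z, g z ∂(coupledLaw f ε n m (lawFrom P π)) = ∫ z, q n (m, z.2) ∂M' := by
    intro n
    have hfl := measurable_flow_apply hf hconv ε n m
    have hgf : Measurable fun ω : CadlagPath S => g (sgp f ε m ω n, ω (n / ε)) :=
      hg.measurable.comp hfl
    have e1 : ∫ z, g z ∂(coupledLaw f ε n m (lawFrom P π)) =
        ∫ ω : CadlagPath S, g (sgp f ε m ω n, ω (n / ε)) ∂(lawFrom P π) := by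
      rw [coupledLaw, integral_map hfl.aemeasurable hg.measurable.aestronglyMeasurable]
    have e2 : ∫ ω : CadlagPath S, g (sgp f ε m ω n, ω (n / ε)) ∂(lawFrom P π) =
        ∫ v, ∫ ω : CadlagPath S, g (sgp f ε m ω n, ω (n / ε)) ∂(P v) ∂π := by
      have : IsProbabilityMeasure (π.bind P) := inferInstance
      exact integral_bind_kernel _ _ (Integrable.of_measurable_of_abs_le hgf fun ω => hg.abs_le _)
    rw [e1, e2, ← hsnd, Measure.snd]
    simp_rw [← integral_evolve (P := P) (ε := ε) hf hconv (n : ℝ≥0) hg.measurable]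
    exact integral_map (f := fun v => q n (m, v)) measurable_snd.aemeasurable
      ((hq n).measurable.comp measurable_prodMk_left).aestronglyMeasurable
  have h2 : ∀ n : ℕ, ∫ z, g z ∂M' = ∫ z, q n z ∂M' := by
    intro n
    have := isMarkovKernel_evolve (P := P) hf hconv ε n
    have h3 := ((isStationaryLaw_iff hf hconv).1 hM').2 n
    have h4 := integral_bind_kernel M' (evolve f ε n P) (hg.integrable _)
    rwa [h3] at h4
  -- No moment of `M'` is known, so the contraction bound is used pointwise only; boundedness of the
  -- test provides the domination.
  have hlim2 : Tendsto (fun n : ℕ => ∫ z, (q n z - q n (m, z.2)) ∂M') atTop (𝓝 0) := by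
    have h3 := tendsto_integral_of_dominated_convergence (μ := M')
      (F := fun (n : ℕ) z => q n z - q n (m, z.2)) (f := fun _ => (0 : ℝ)) (fun _ => c + c)
      (fun n => ((hq n).measurable.sub (hqm n)).aestronglyMeasurable) (integrable_const _)
      (fun n => Eventually.of_forall fun z => (norm_sub_le _ _).trans
        (add_le_add ((hq n).abs_le _) ((hq n).abs_le _)))
      (Eventually.of_forall fun z => by
        refine squeeze_zero_norm (fun n => hg.integral_evolve_sub_le hf hconv n hL z.1 m z.2) ?_
        simpa using (hex.mul_const ‖z.1 - m‖).const_mul L)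
    simpa using h3
  have h5 : ∀ n : ℕ, ∫ z, (q n z - q n (m, z.2)) ∂M' =
      ∫ z, g z ∂M' - ∫ z, g z ∂(coupledLaw f ε n m (lawFrom P π)) := fun n => by
    rw [integral_sub ((hq n).integrable M') (Integrable.of_measurable_of_abs_le (hqm n)
      fun z => (hq n).abs_le _), ← h1, ← h2]
  simp_rw [h5] at hlim2
  exact sub_eq_zero.1 (tendsto_nhds_unique (tendsto_const_nhds.sub hlim1) hlim2)

/-- The laws of the process started from `(m, a)` and from `(m, π)` merge exponentially fast. -/
theorem wasserstein_coupledLaw_le (hf : IsRegularTarget f) (hconv : IsUniformlyStronglyConvex f κ)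
    (hκ : 0 < κ) (hP : IsFellerProcess P)
    (hR : ∀ (ω : CadlagPath S) t, ‖sgp f ε m ω t‖ ≤ R) {C δ : ℝ} (hC : 0 < C)
    (hc : HasExponentialCoupling.{u, v} P π C δ) (hε : 0 < ε) (hεδ : (ε : ℝ) ≤ δ / (2 * κ))
    (a : S) (t : ℝ≥0) :
    wasserstein coupledDist (coupledLaw f ε t m (P a)) (coupledLaw f ε t m (lawFrom P π)) ≤
      ENNReal.ofReal ((C + 2 * R) * Real.exp (-κ * t / 2)) := by
  obtain ⟨Ω, mΩ, μ, X, Z, hμ, hX, hZ, hXa, hZπ, hE⟩ := hc.exists_merging hP a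
  -- Half of the time is left for the index paths to merge and half for the parameters to contract;
  -- `t / 2` is `t / 2 / ε` on the clock of the index.
  obtain ⟨E, hEm, hμE, hXZ⟩ := hE (t / 2 / ε)
  have hfl := measurable_flow_apply hf hconv ε t m
  rw [← hXa, ← hZπ, coupledLaw, coupledLaw, Measure.map_map hfl hX, Measure.map_map hfl hZ]
  have hε' : (0 : ℝ) < ε := by exact_mod_cast hε
  -- The restriction on `ε` enters here: it gives `κ ≤ δ / ε`, with a factor `2` to spare, so
  -- failure to merge is as rare as the target rate demands.
  have hCe : C * Real.exp (-δ * ((t / 2 / ε : ℝ≥0) : ℝ)) ≤ C * Real.exp (-κ * t / 2) := by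
    gcongr
    have h1 : 2 * κ * ε ≤ δ := by
      rw [le_div_iff₀ (by positivity)] at hεδ
      linarith
    have h2 : κ ≤ δ / ε := by
      rw [le_div_iff₀ hε']
      nlinarith
    have h3 := t.coe_nonneg
    push_cast
    have h4 : -δ * ((t : ℝ) / 2 / ε) = -(δ / ε) * t / 2 := by ring
    rw [h4]
    nlinarith
  have hpt : ∀ ω ∉ E, coupledDist (sgp f ε m (X ω) t, X ω (t / ε)) (sgp f ε m (Z ω) t, Z ω (t / ε)) ≤
      2 * R * Real.exp (-κ * t / 2) := by
    intro ω hω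
    have h1 := hXZ ω hω
    have h2 : X ω (t / ε) = Z ω (t / ε) := h1 _ (by gcongr; exact half_le_self (zero_le))
    rw [coupledDist_of_eq h2]
    refine (min_le_right _ _).trans ?_
    have h3 : t = t / 2 + t / 2 := (add_halves t).symm
    have h4 : (X ω).shift (t / 2 / ε) = (Z ω).shift (t / 2 / ε) :=
      Subtype.ext (funext fun s => h1 _ le_self_add)
    change ‖sgp f ε m (X ω) t - sgp f ε m (Z ω) t‖ ≤ _
    rw [h3, sgp_add hf hconv, sgp_add hf hconv, h4, ← h3]
    refine (norm_sgp_sub_sgp_le hf hconv ε _ _ _ _).trans ?_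
    have h5 : -κ * ((t / 2 : ℝ≥0) : ℝ) = -κ * t / 2 := by push_cast; ring
    rw [h5, mul_comm]
    gcongr
    exact (norm_sub_le _ _).trans (by linarith [hR (X ω) (t / 2), hR (Z ω) (t / 2)])
  have hR0 : 0 ≤ R := (norm_nonneg _).trans (hR (X (Classical.choice
    (nonempty_of_isProbabilityMeasure μ))) 0)
  calc _ ≤ ∫⁻ ω, ENNReal.ofReal (coupledDist (sgp f ε m (X ω) t, X ω (t / ε))
          (sgp f ε m (Z ω) t, Z ω (t / ε))) ∂μ := wasserstein_map_le _ _ (hfl.comp hX) (hfl.comp hZ)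
    _ ≤ ∫⁻ ω, (E.indicator 1 ω + ENNReal.ofReal (2 * R * Real.exp (-κ * t / 2))) ∂μ := by
        refine lintegral_mono fun ω => ?_
        by_cases hω : ω ∈ E
        · rw [indicator_of_mem hω]
          refine le_add_right ?_
          exact (ENNReal.ofReal_le_ofReal (coupledDist_le_one _ _)).trans_eq ENNReal.ofReal_one
        · exact le_add_left (ENNReal.ofReal_le_ofReal (hpt ω hω))
    _ = μ E + ENNReal.ofReal (2 * R * Real.exp (-κ * t / 2)) := by
        rw [lintegral_add_right _ measurable_const, lintegral_indicator_one hEm]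
        simp
    _ ≤ ENNReal.ofReal (C * Real.exp (-κ * t / 2)) +
          ENNReal.ofReal (2 * R * Real.exp (-κ * t / 2)) := by
        gcongr
        exact hμE.trans (ENNReal.ofReal_le_ofReal hCe)
    _ = _ := by
        rw [← ENNReal.ofReal_add (by positivity) (by positivity), add_mul]

end Stationary

end

/-! ### Assembly of the convergence bounds -/

theorem mainTheorem5 {S : Type u} [TopologicalSpace S] [CompactSpace S] [PolishSpace S]
    [MeasurableSpace S] [BorelSpace S] {K : ℕ}
    (f : ParamSpace K → S → ℝ) (hf : IsRegularTarget f)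
    (κ : ℝ) (hκ : 0 < κ) (hconv : IsUniformlyStronglyConvex f κ)
    (m : ParamSpace K) (C : ℝ) (hC : 0 < C) :
    ∃ D : ℝ, ∀ (P : Kernel S (CadlagPath S)), IsFellerProcess P →
      ∀ π : Measure S, IsInvariantLaw P π → (∀ π' : Measure S, IsInvariantLaw P π' → π' = π) →
      ∀ δ : ℝ, 0 < δ → HasExponentialCoupling.{u, v} P π C δ →
      ∀ ε : ℝ≥0, 0 < ε → (ε : ℝ) ≤ min 1 (δ / (2 * κ)) →
      ∃ M : Measure (ParamSpace K × S),
        IsStationaryLaw f ε P M ∧ (∀ M', IsStationaryLaw f ε P M' → M' = M) ∧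
        ∀ (a : S) (t : ℝ≥0),
          wasserstein coupledDist (coupledLaw f ε t m (P a)) M
            ≤ ENNReal.ofReal (D * Real.exp (-κ * t / 2)) ∧
          wasserstein coupledDist (coupledLaw f ε t m (lawFrom P π)) M
            ≤ ENNReal.ofReal (D * Real.exp (-κ * t / 2)) ∧
          wasserstein truncDist (sgpLaw f ε t m (P a)) M.fst
            ≤ ENNReal.ofReal (D * Real.exp (-κ * t / 2)) ∧
          wasserstein truncDist (sgpLaw f ε t m (lawFrom P π)) M.fst
            ≤ ENNReal.ofReal (D * Real.exp (-κ * t / 2)) ∧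
          wasserstein truncDist (sgpLaw f ε t m (P a)) (sgpLaw f ε t m (lawFrom P π))
            ≤ ENNReal.ofReal (D * Real.exp (-κ * t / 2)) := by
  obtain ⟨B, hB0, hB'⟩ := hf.exists_bound (isCompact_singleton (x := (0 : ParamSpace K)))
  have hB : ∀ v, ‖gradTarget f 0 v‖ ≤ B := hB' 0 rfl
  set R : ℝ := ‖m‖ + B / κ with hRdef
  have hm : ‖m‖ ≤ R := le_add_of_nonneg_right (by positivity)
  have hR0 : 0 ≤ R := (norm_nonneg m).trans hm
  -- `C + 2 R` is the cost of merging the starts `(m, a)` and `(m, π)`, and the remaining `2 R`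
  -- bounds the distance from the latter to `M`. The constant is fixed before the index process, `δ`
  -- and `ε` are introduced.
  refine ⟨C + 4 * R, fun P hP π hπ huniq δ hδ hc ε hε hεδ => ?_⟩
  have hR : ∀ (ω : CadlagPath S) t, ‖sgp f ε m ω t‖ ≤ R := norm_sgp_le hf hconv hκ hB ε m
  have := hπ.1
  have : IsMarkovKernel P := ⟨hP.isProbability⟩
  obtain ⟨M, hMp, hM⟩ := exists_limit_coupledLaw hf hconv hP hπ hR hm
  refine ⟨M, isStationaryLaw_of_areNear hf hconv hκ hP hπ hM,
    fun M' hM' => hM'.eq_of_areNear hf hconv hκ hP hπ huniq hε hM, fun a t => ?_⟩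
  have hpa := isProbabilityMeasure_coupledLaw (ε := ε) hf hconv t m (P a)
  have hpπ := isProbabilityMeasure_coupledLaw (ε := ε) hf hconv t m (lawFrom P π)
  have hexp : Real.exp (-κ * t) ≤ Real.exp (-κ * t / 2) := by
    refine Real.exp_le_exp.2 ?_
    have := mul_nonneg hκ.le t.coe_nonneg
    linarith
  have h0 := Real.exp_nonneg (-κ * t / 2)
  have hπM : wasserstein coupledDist (coupledLaw f ε t m (lawFrom P π)) M ≤
      ENNReal.ofReal (2 * R * Real.exp (-κ * t / 2)) :=
    (hM t).wasserstein_le.trans (ENNReal.ofReal_le_ofReal (by gcongr))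
  have haπ := wasserstein_coupledLaw_le hf hconv hκ hP hR hC hc hε (hεδ.trans (min_le_right _ _)) a t
  have : Nonempty S := ⟨a⟩
  have haM : wasserstein coupledDist (coupledLaw f ε t m (P a)) M ≤
      ENNReal.ofReal ((C + 4 * R) * Real.exp (-κ * t / 2)) := by
    refine (wasserstein_triangle measurable_coupledDist coupledDist_nonneg coupledDist_triangle _
      (coupledLaw f ε t m (lawFrom P π)) _).trans ((add_le_add haπ hπM).trans_eq ?_)
    rw [← ENNReal.ofReal_add (by positivity) (by positivity)]
    ring_nf
  have hπM' := hπM.trans (ENNReal.ofReal_le_ofReal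
    (mul_le_mul_of_nonneg_right (by linarith : 2 * R ≤ C + 4 * R) h0))
  have haπ' := haπ.trans (ENNReal.ofReal_le_ofReal
    (mul_le_mul_of_nonneg_right (by linarith : C + 2 * R ≤ C + 4 * R) h0))
  rw [← coupledLaw_fst hf hconv, ← coupledLaw_fst hf hconv]
  exact ⟨haM, hπM', (wasserstein_truncDist_fst_le _ _).trans haM,
    (wasserstein_truncDist_fst_le _ _).trans hπM', (wasserstein_truncDist_fst_le _ _).trans haπ'⟩
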